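/- Let $X_1,\dots,X_n$ ($n\ge 1$) be variables with nonempty interval domains $D(X_i)=[lb_i,ub_i]\subseteq\{1,\dots,d\}$, and let $S\cup T=\{X_1,\dots,X_n\}$. A solution is an assignment of values from the domains that is injective on $S$ and injective on $T$ (a simultaneous matching of the variable/value graph). For a set $P$ of variables put $N(P)=\bigcup_{X\in P}D(X)$, $P^S=P\cap(S\setminus T)$, $P^T=P\cap(T\setminus S)$; $P$ is an almost simultaneous Hall set if $|N(P)|+|N(P^S)\cap N(P^T)|=|P|+1$. Rule 3 says: for each almost simultaneous Hall set $P$, if $u\in(S\cap T)\setminus P$ then no value $v\in N(P^S)\cap N(P^T)$ is in the domain of $u$. Introduce 0/1 variables $b_{il}$, $a_{ilu}$ (with $b_{i0}=0$) and counters $C^{ST}_{lu},C^S_{lu},C^T_{lu}$ with values in $[0,n]$ (with $C^{ST}_{10}=0$), and the constraints, for $1\le i\le n$, $1\le l\le u\le d$, $u-l<n$: (1) $b_{il}=1\iff X_i\le l$; (2) $a_{ilu}=1\iff(b_{i(l-1)}=0\wedge b_{iu}=1)$; (3) $C^{ST}_{lu}=\sum_{i\in S\cap T}a_{ilu}$;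 (4) $C^{S}_{lu}=\sum_{i\in S\setminus T}a_{ilu}$; (5) $C^{T}_{lu}=\sum_{i\in T\setminus S}a_{ilu}$; (6) $C^{ST}_{1u}=C^{ST}_{1l}+C^{ST}_{(l+1)u}$; (7) $C^{ST}_{lu}+C^{S}_{lu}\le u-l+1$; (8) $C^{ST}_{lu}+C^{T}_{lu}\le u-l+1$; and for $1\le l\le u\le d$: (9) $C^{T}_{1u}=C^{T}_{1l}+C^{T}_{(l+1)u}$; (10) $C^{S}_{1u}=C^{S}_{1l}+C^{S}_{(l+1)u}$; and finally $C^{ST}_{lu}=C^{ST}_{lk}+C^{ST}_{(k+1)u}$ for $2\le l\le k\le u\le d$. Suppose that these constraints are at a fixpoint of bound consistency propagation: all domains are nonempty intervals, the domain of $X_i$ is $[lb_i,ub_i]$, and every constraint is bound consistent. Then Rule 3 can be enforced in $O(nd^3)$ additional time: there are a fixed program for a unit-cost random access machine and an absolute constant $c$ such that, for every such instance, the program, given $n$, $d$, the bounds $lb_i,ub_i$ and the characteristic vectors of $S$ and $T$, halts after at most $c\,n\,d^3$ steps and outputs domains $D'(X_i)\subseteq D(X_i)$ such that $D'(X_i)=D(X_i)$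 for $X_i\notin S\cap T$, every value that is used by a solution is kept, and every value that Rule 3 excludes is removed (that is, for each almost simultaneous Hall set $P$ with respect to $D$, each $u\in(S\cap T)\setminus P$ and each $v\in N(P^S)\cap N(P^T)$, $v\notin D'(u)$). -/

import Mathlib

/-! ## Overlapping bipartite graphs, simultaneous matchings, almost simultaneous Hall sets

Variables are `Fin n`, values are natural numbers.  A bipartite variable/value graph is given by the
neighbourhood `D i` of each variable `i`. -/

/-- The neighbourhood `N(P)` of a set `P` of variables. -/
def nbhd {n : ℕ} (D : Fin n → Finset ℕ) (P : Finset (Fin n)) : Finset ℕ :=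
  P.biUnion D

/-- `N(P^S) ∩ N(P^T)`, where `P^S = P ∩ (S \ T)` and `P^T = P ∩ (T \ S)`. -/
def commonNbhd {n : ℕ} (D : Fin n → Finset ℕ) (S T P : Finset (Fin n)) : Finset ℕ :=
  nbhd D (P ∩ (S \ T)) ∩ nbhd D (P ∩ (T \ S))

/-- `P` is an almost simultaneous Hall set. -/
def IsAlmostSimHallSet {n : ℕ} (D : Fin n → Finset ℕ) (S T P : Finset (Fin n)) : Prop :=
  (nbhd D P).card + (commonNbhd D S T P).card = P.card + 1

/-- The edges of `M` are pairwise non-adjacent, and every vertex of `Q` is incident to exactly one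
edge of `M`. -/
def IsMatchingCovering {n : ℕ} (M : Finset (Fin n × ℕ)) (Q : Finset (Fin n)) : Prop :=
  (∀ e ∈ M, ∀ e' ∈ M, e ≠ e' → e.1 ≠ e'.1 ∧ e.2 ≠ e'.2) ∧
  ∀ i ∈ Q, ∃! e, e ∈ M ∧ e.1 = i

/-- `M` is a simultaneous matching of the graph `D` with respect to `S` and `T`; that is, a solution
of the conjunction of the two all-different constraints on `S` and on `T`. -/
def IsSimMatching {n : ℕ} (D : Fin n → Finset ℕ) (S T : Finset (Fin n))
    (M : Finset (Fin n × ℕ)) : Prop :=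
  (∀ e ∈ M, e.2 ∈ D e.1) ∧
  IsMatchingCovering (M.filter fun e => e.1 ∈ S) S ∧
  IsMatchingCovering (M.filter fun e => e.1 ∈ T) T

/-- Rule 3 for the graph `D`, as a condition on domains `D'`: for each almost simultaneous Hall set
`P` of `D`, if `u ∈ (S ∩ T) \ P` then no `v ∈ N(P^S) ∩ N(P^T)` is in the domain of `u`. -/
def RuleThree {n : ℕ} (D : Fin n → Finset ℕ) (S T : Finset (Fin n)) (D' : Fin n → Finset ℕ) :
    Prop :=
  ∀ P : Finset (Fin n), IsAlmostSimHallSet D S T P →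
    ∀ u ∈ (S ∩ T) \ P, ∀ v ∈ commonNbhd D S T P, v ∉ D' u

/-- Passing from the domains `D` to the domains `D'` enforces Rule 3: values are only removed, and
only from variables in `S ∩ T`; no solution is lost; and every value excluded by the rule is
removed. -/
structure EnforcesRuleThree {n : ℕ} (D : Fin n → Finset ℕ) (S T : Finset (Fin n))
    (D' : Fin n → Finset ℕ) : Prop where
  subset : ∀ u, D' u ⊆ D u
  eq_of_notMem : ∀ u, u ∉ S ∩ T → D' u = D u
  sound : ∀ M, IsSimMatching D S T M → ∀ e ∈ M, e.2 ∈ D' e.1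
  rule : RuleThree D S T D'

/-! ## The overlapping all-different constraint with interval domains -/

/-- An instance: `n` variables `X_i`, values `1, …, d`, sets `S` and `T` with `S ∪ T` the set of all
variables, and nonempty interval domains `[lb i, ub i]`. -/
structure OverlappingAllDiff (n d : ℕ) where
  S : Finset (Fin n)
  T : Finset (Fin n)
  cover : S ∪ T = Finset.univ
  lb : Fin n → ℕ
  ub : Fin n → ℕ
  one_le_lb : ∀ i, 1 ≤ lb i
  lb_le_ub : ∀ i, lb i ≤ ub i
  ub_le : ∀ i, ub i ≤ d

/-- The (convex) variable/value graph of an instance. -/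
def OverlappingAllDiff.dom {n d : ℕ} (I : OverlappingAllDiff n d) (i : Fin n) : Finset ℕ :=
  Finset.Icc (I.lb i) (I.ub i)

/-! ## Bound consistency and the decomposition -/

/-- The variables of the decomposition: `X_i`, `b_{il}`, `a_{ilu}`, `C^{ST}_{lu}`, `C^S_{lu}` and
`C^T_{lu}`. -/
inductive DVar (n : ℕ) where
  | X (i : Fin n)
  | b (i : Fin n) (l : ℕ)
  | a (i : Fin n) (l u : ℕ)
  | CST (l u : ℕ)
  | CS (l u : ℕ)
  | CT (l u : ℕ)
  deriving DecidableEq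

/-- A constraint over variables in `V`: its scope and the assignments that satisfy it. -/
structure Constr (V : Type) where
  scope : Finset V
  holds : (V → ℕ) → Prop

/-- A constraint is bound consistent for the bounds `lo`, `hi`: when a variable of its scope is
assigned its minimum or its maximum, there are compatible values between the bounds of all the other
variables. -/
def Constr.BoundConsistent {V : Type} (c : Constr V) (lo hi : V → ℕ) : Prop :=
  ∀ x ∈ c.scope, ∀ v, v = lo x ∨ v = hi x →
    ∃ α : V → ℕ, α x = v ∧ (∀ y ∈ c.scope, lo y ≤ α y ∧ α y ≤ hi y) ∧ c.holds α

/-- The range of the indices `l`, `u` of the first group of constraints. -/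
def InRange (n d l u : ℕ) : Prop := 1 ≤ l ∧ l ≤ u ∧ u ≤ d ∧ u - l < n

namespace OverlappingAllDiff

open DVar

variable {n d : ℕ} (I : OverlappingAllDiff n d)

/-- The constraints of the decomposition, each on its own range of indices. -/
inductive IsDecompConstr : Constr (DVar n) → Prop
  /-- `b_{il} = 1 ↔ X_i ≤ l` -/
  | chanB (i : Fin n) (l : ℕ) : 1 ≤ l → l ≤ d →
      IsDecompConstr ⟨{b i l, X i}, fun α => α (b i l) = 1 ↔ α (X i) ≤ l⟩
  /-- `a_{ilu} = 1 ↔ b_{i(l-1)} = 0 ∧ b_{iu} = 1` -/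
  | chanA (i : Fin n) (l u : ℕ) : InRange n d l u →
      IsDecompConstr ⟨{a i l u, b i (l - 1), b i u},
        fun α => α (a i l u) = 1 ↔ (α (b i (l - 1)) = 0 ∧ α (b i u) = 1)⟩
  /-- `C^{ST}_{lu} = ∑_{i ∈ S ∩ T} a_{ilu}` -/
  | sumST (l u : ℕ) : InRange n d l u →
      IsDecompConstr ⟨insert (CST l u) ((I.S ∩ I.T).image fun i => a i l u),
        fun α => α (CST l u) = ∑ i ∈ I.S ∩ I.T, α (a i l u)⟩
  /-- `C^S_{lu} = ∑_{i ∈ S \ T} a_{ilu}` -/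
  | sumS (l u : ℕ) : InRange n d l u →
      IsDecompConstr ⟨insert (CS l u) ((I.S \ I.T).image fun i => a i l u),
        fun α => α (CS l u) = ∑ i ∈ I.S \ I.T, α (a i l u)⟩
  /-- `C^T_{lu} = ∑_{i ∈ T \ S} a_{ilu}` -/
  | sumT (l u : ℕ) : InRange n d l u →
      IsDecompConstr ⟨insert (CT l u) ((I.T \ I.S).image fun i => a i l u),
        fun α => α (CT l u) = ∑ i ∈ I.T \ I.S, α (a i l u)⟩
  /-- `C^{ST}_{1u} = C^{ST}_{1l} + C^{ST}_{(l+1)u}` -/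
  | pyramidST (l u : ℕ) : InRange n d l u →
      IsDecompConstr ⟨{CST 1 u, CST 1 l, CST (l + 1) u},
        fun α => α (CST 1 u) = α (CST 1 l) + α (CST (l + 1) u)⟩
  /-- `C^{ST}_{lu} + C^S_{lu} ≤ u - l + 1` -/
  | capS (l u : ℕ) : InRange n d l u →
      IsDecompConstr ⟨{CST l u, CS l u}, fun α => α (CST l u) + α (CS l u) ≤ u - l + 1⟩
  /-- `C^{ST}_{lu} + C^T_{lu} ≤ u - l + 1` -/
  | capT (l u : ℕ) : InRange n d l u →
      IsDecompConstr ⟨{CST l u, CT l u}, fun α => α (CST l u) + α (CT l u) ≤ u - l + 1⟩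
  /-- `C^T_{1u} = C^T_{1l} + C^T_{(l+1)u}` -/
  | pyramidT (l u : ℕ) : 1 ≤ l → l ≤ u → u ≤ d →
      IsDecompConstr ⟨{CT 1 u, CT 1 l, CT (l + 1) u},
        fun α => α (CT 1 u) = α (CT 1 l) + α (CT (l + 1) u)⟩
  /-- `C^S_{1u} = C^S_{1l} + C^S_{(l+1)u}` -/
  | pyramidS (l u : ℕ) : 1 ≤ l → l ≤ u → u ≤ d →
      IsDecompConstr ⟨{CS 1 u, CS 1 l, CS (l + 1) u},
        fun α => α (CS 1 u) = α (CS 1 l) + α (CS (l + 1) u)⟩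
  /-- general interval splitting: `C^{ST}_{lu} = C^{ST}_{lk} + C^{ST}_{(k+1)u}` -/
  | splitST (l k u : ℕ) : 2 ≤ l → l ≤ k → k ≤ u → u ≤ d →
      IsDecompConstr ⟨{CST l u, CST l k, CST (k + 1) u},
        fun α => α (CST l u) = α (CST l k) + α (CST (k + 1) u)⟩

/-- The bounds `lo`, `hi` of the variables of the decomposition are a fixpoint of bound consistency
propagation at which the domain of `X_i` is `[lb i, ub i]`: all domains are nonempty and contained in
the initial ones (`{0, 1}` for `a` and `b`, with the constant `b_{i0} = 0`; `[0, n]` for the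
counters, with the constant `C^{ST}_{10} = 0`), and every constraint is bound consistent. -/
structure AtFixpoint (lo hi : DVar n → ℕ) : Prop where
  lo_X : ∀ i, lo (X i) = I.lb i
  hi_X : ∀ i, hi (X i) = I.ub i
  nonempty : ∀ x, lo x ≤ hi x
  hi_b : ∀ i l, hi (b i l) ≤ 1
  hi_a : ∀ i l u, hi (a i l u) ≤ 1
  hi_CST : ∀ l u, hi (CST l u) ≤ n
  hi_CS : ∀ l u, hi (CS l u) ≤ n
  hi_CT : ∀ l u, hi (CT l u) ≤ n
  b_zero : ∀ i, hi (b i 0) = 0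
  CST_zero : hi (CST 1 0) = 0
  consistent : ∀ c, I.IsDecompConstr c → c.BoundConsistent lo hi

end OverlappingAllDiff

/-! ## A random access machine with step count

Programs of a structured language over finitely many arrays of natural numbers, all cells of which
can be addressed indirectly.  The arithmetic operations are addition and truncated subtraction. -/

/-- Memory: `σ k j` is cell `j` of array `k`. -/
abbrev Memory := ℕ → ℕ → ℕ

/-- Expressions; `cell k e` is the content of the cell of array `k` whose index is the value of
`e`. -/
inductive RExpr where
  | const (c : ℕ)
  | cell (k : ℕ) (e : RExpr)
  | add (e₁ e₂ : RExpr)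
  | sub (e₁ e₂ : RExpr)

/-- The value of an expression. -/
def RExpr.eval (σ : Memory) : RExpr → ℕ
  | .const c => c
  | .cell k e => σ k (e.eval σ)
  | .add e₁ e₂ => e₁.eval σ + e₂.eval σ
  | .sub e₁ e₂ => e₁.eval σ - e₂.eval σ

/-- The number of steps that the evaluation of an expression takes: one for each constant, memory
access and arithmetic operation. -/
def RExpr.cost : RExpr → ℕ
  | .const _ => 1
  | .cell _ e => e.cost + 1
  | .add e₁ e₂ => e₁.cost + e₂.cost + 1
  | .sub e₁ e₂ => e₁.cost + e₂.cost + 1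

/-- Programs; `store k e₁ e₂` writes the value of `e₂` into cell `e₁` of array `k`, and a test
succeeds if the value of its expression is not zero. -/
inductive RProg where
  | skip
  | store (k : ℕ) (e₁ e₂ : RExpr)
  | seq (p q : RProg)
  | ite (e : RExpr) (p q : RProg)
  | loop (e : RExpr) (p : RProg)

/-- `Runs p σ t τ`: started in the memory `σ`, the program `p` halts after exactly `t` steps in the
memory `τ`. -/
inductive Runs : RProg → Memory → ℕ → Memory → Prop
  | skip (σ : Memory) : Runs .skip σ 1 σ
  | store (k : ℕ) (e₁ e₂ : RExpr) (σ : Memory) :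
      Runs (.store k e₁ e₂) σ (e₁.cost + e₂.cost + 1)
        (Function.update σ k (Function.update (σ k) (e₁.eval σ) (e₂.eval σ)))
  | seq {p q : RProg} {σ σ' σ'' : Memory} {t t' : ℕ} :
      Runs p σ t σ' → Runs q σ' t' σ'' → Runs (.seq p q) σ (t + t') σ''
  | ite_true {e : RExpr} {p q : RProg} {σ σ' : Memory} {t : ℕ} :
      e.eval σ ≠ 0 → Runs p σ t σ' → Runs (.ite e p q) σ (e.cost + 1 + t) σ'
  | ite_false {e : RExpr} {p q : RProg} {σ σ' : Memory} {t : ℕ} :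
      e.eval σ = 0 → Runs q σ t σ' → Runs (.ite e p q) σ (e.cost + 1 + t) σ'
  | loop_done {e : RExpr} {p : RProg} {σ : Memory} :
      e.eval σ = 0 → Runs (.loop e p) σ (e.cost + 1) σ
  | loop_step {e : RExpr} {p : RProg} {σ σ' σ'' : Memory} {t t' : ℕ} :
      e.eval σ ≠ 0 → Runs p σ t σ' → Runs (.loop e p) σ' t' σ'' →
      Runs (.loop e p) σ (e.cost + 1 + t + t') σ''

/-- An array whose first cells are given by `f` and whose other cells are zero. -/
def arrayOf {n : ℕ} (f : Fin n → ℕ) (j : ℕ) : ℕ :=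
  if h : j < n then f ⟨j, h⟩ else 0

/-- The initial memory: array 0 holds `n` and `d`; arrays 1 and 2 hold the bounds of the domains;
arrays 3 and 4 are the characteristic vectors of `S` and `T`; all other cells are zero. -/
def OverlappingAllDiff.initialMemory {n d : ℕ} (I : OverlappingAllDiff n d) : Memory
  | 0 => arrayOf ![n, d]
  | 1 => arrayOf I.lb
  | 2 => arrayOf I.ub
  | 3 => arrayOf fun i => if i ∈ I.S then 1 else 0
  | 4 => arrayOf fun i => if i ∈ I.T then 1 else 0
  | _ => fun _ => 0

/-- The domains that a final memory represents: array 5 is a table with rows `0, …, n - 1` and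
columns `0, …, d`, in row-major order, whose nonzero entries mark the remaining values. -/
def outputDomains (n d : ℕ) (τ : Memory) (i : Fin n) : Finset ℕ :=
  (Finset.Icc 1 d).filter fun v => τ 5 ((i : ℕ) * (d + 1) + v) ≠ 0

/-! Read 0, …, d as nodes and an interval of values as (p, q]. In a solution, the variables of S ∩ T
with value in (p, q] share these q - p values with the variables of S \ T confined to (p, q]; so
their number m(p, q) is at most the slack of S \ T there, and likewise for T \ S. As m is
subadditive, it is at most the shortest-path distance `dist` for the smaller of the two slacks.
`Consistent` collects the resulting necessary conditions.

Now let a variable of S ∩ T take the value w + 1, and let m count the other variables of S ∩ T. An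
interval through w + 1 has a value less to offer, so its slack is at least m + 1. A cover of (l, u]
containing an interval paid by S \ T and one paid by T \ S, both through w + 1, therefore costs at
least m(l, u) + 2. `Excluded` is the violation of this bound at the cheapest such cover, and
soundness is `not_excluded_of_solution`.

Conversely, let P be almost simultaneous Hall with w + 1 in its common neighbourhood. A piece Q of P
has neighbourhood a single interval (l, u], still contains w + 1 in its common neighbourhood, and
still has |N(Q)| + |N(Q^S) ∩ N(Q^T)| ≤ |Q| + 1: the discarded pieces cannot have negative excess, by
the Hall condition `card_le_nbhd_add_commonNbhd`. The maximal runs of N(Q^S) and N(Q^T), with a unit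
step for each value they miss, form a cover of (l, u]; by inclusion-exclusion it costs at most 1 +
|Q ∩ S ∩ T|. One run of each kind passes through w + 1, so the test fires for every variable of S ∩
T outside Q (`excluded_of_isAlmostSimHallSet`).

For the time bound, distances take d³ steps. For each w, the two intervals through w + 1 are
optimized almost independently (`reachTwice`), with tables of d² entries. The later right end of the
two runs is the upper bound of some variable, so the last minimum has n candidates rather than d,
which gives n d² per value. The program is written with loops whose bounds are known in advance: its
running time is read off from the syntax (`exists_runs_exec`), its effect from loop invariants. -/

/-! ## Shortest paths -/

/-- Floyd–Warshall relaxation of `f` through the intermediate nodes `0, …, k - 1`. -/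
def relax (f : ℕ → ℕ → ℕ) : ℕ → ℕ → ℕ → ℕ
  | 0 => f
  | k + 1 => fun p q => min (relax f k p q) (relax f k p k + relax f k k q)

theorem relax_le (f : ℕ → ℕ → ℕ) (k p q : ℕ) : relax f k p q ≤ f p q := by
  induction k with
  | zero => exact le_rfl
  | succ k ih => exact (min_le_left _ _).trans ih

/-- Round `k` leaves row and column `k` unchanged, since lengths are nonnegative; this settles the
new node `r = k`. -/
theorem relax_triangle (f : ℕ → ℕ → ℕ) {k r : ℕ} (hr : r < k) (p q : ℕ) :
    relax f k p q ≤ relax f k p r + relax f k r q := by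
  induction k generalizing p q with
  | zero => omega
  | succ k ih =>
    simp only [relax]
    rcases Nat.lt_succ_iff_lt_or_eq.mp hr with h | rfl
    · have h1 := ih h p q
      have h2 := ih h p k
      have h3 := ih h k q
      omega
    · omega

/-- Subadditive lower bounds survive relaxation. This bounds distances from below without mentioning
paths. -/
theorem le_relax {f m : ℕ → ℕ → ℕ} (hm : ∀ p q, m p q ≤ f p q)
    (ht : ∀ p r q, m p q ≤ m p r + m r q) (k p q : ℕ) : m p q ≤ relax f k p q := by
  induction k generalizing p q with
  | zero => exact hm p q
  | succ k ih => exact le_min (ih p q) ((ht p k q).trans (add_le_add (ih p k) (ih k q)))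

/-- The minimum of `c` and `f 0, …, f (N - 1)`. -/
def runMin (c : ℕ) (f : ℕ → ℕ) : ℕ → ℕ
  | 0 => c
  | N + 1 => min (runMin c f N) (f N)

theorem le_runMin {b c : ℕ} {f : ℕ → ℕ} {N : ℕ} (hc : b ≤ c) (hf : ∀ j < N, b ≤ f j) :
    b ≤ runMin c f N := by
  induction N with
  | zero => exact hc
  | succ N ih => exact le_min (ih fun j hj => hf j (by omega)) (hf N (by omega))

theorem runMin_le {c : ℕ} {f : ℕ → ℕ} {N j : ℕ} (hj : j < N) : runMin c f N ≤ f j := by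
  induction N with
  | zero => omega
  | succ N ih =>
    rcases Nat.lt_succ_iff_lt_or_eq.mp hj with h | rfl
    · exact (min_le_left _ _).trans (ih h)
    · exact min_le_right _ _

/-- If the intervals `(lo r, hi r]`, `r ∈ F`, are bridged at cost `c r`, then `(l, u]` is bridged at
the total cost of all of them plus one for every point of `(l, u]` that they miss. -/
theorem dist_le_uncovered_add_sum {d : ℕ} {D : ℕ → ℕ → ℕ} (hD : ∀ p q, D p q ≤ q - p)
    (ht : ∀ p q, ∀ r ≤ d, D p q ≤ D p r + D r q) {ι : Type*} [DecidableEq ι] (lo hi c : ι → ℕ)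
    (l u : ℕ) (F : Finset ι) (hF : ∀ r ∈ F, lo r < hi r ∧ hi r ≤ d ∧ D (lo r) (hi r) ≤ c r)
    (hu : u ≤ d) :
    D l u ≤ ((Finset.Ioc l u).filter fun x => ∀ r ∈ F, ¬ (lo r < x ∧ x ≤ hi r)).card +
      ∑ r ∈ F, c r := by
  induction u using Nat.strong_induction_on generalizing F with
  | _ u ih =>
    by_cases hlu : u ≤ l
    · have := hD l u
      omega
    -- Walk back from `u`. An uncovered `u` costs one unit step from `u - 1`. A covered one is
    -- reached by jumping from `lo r` to `hi r` and returning to `u` for free, since `D (hi r) u ≤ u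
    -- - hi r = 0`; then `r` is erased, so it is paid only once.
    by_cases hx : ∀ r ∈ F, ¬ (lo r < u ∧ u ≤ hi r)
    · have h1 := ih (u - 1) (by omega) F hF (by omega)
      have h2 := ht l u (u - 1) (by omega)
      have h3 := hD (u - 1) u
      have h4 : insert u ((Finset.Ioc l (u - 1)).filter fun x => ∀ r ∈ F, ¬ (lo r < x ∧ x ≤ hi r)) ⊆
          (Finset.Ioc l u).filter fun x => ∀ r ∈ F, ¬ (lo r < x ∧ x ≤ hi r) := by
        intro x
        simp only [Finset.mem_insert, Finset.mem_filter, Finset.mem_Ioc]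
        rintro (rfl | ⟨h, h'⟩)
        · exact ⟨by omega, hx⟩
        · exact ⟨by omega, h'⟩
      have h5 := Finset.card_le_card h4
      rw [Finset.card_insert_of_notMem (by simp; omega)] at h5
      omega
    · push Not at hx
      obtain ⟨r, hr, h1, h2⟩ := hx
      obtain ⟨-, h3, h4⟩ := hF r hr
      have h5 := ih (lo r) h1 (F.erase r) (fun s hs => hF s (Finset.mem_of_mem_erase hs)) (by omega)
      have h6 := Finset.add_sum_erase F c hr
      have h7 := ht l u (lo r) (by omega)
      have h8 := ht (lo r) u (hi r) h3
      have h9 := hD (hi r) u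
      have h10 : ((Finset.Ioc l (lo r)).filter fun x => ∀ s ∈ F.erase r, ¬ (lo s < x ∧ x ≤ hi s)) ⊆
          (Finset.Ioc l u).filter fun x => ∀ s ∈ F, ¬ (lo s < x ∧ x ≤ hi s) := by
        intro x
        simp only [Finset.mem_filter, Finset.mem_Ioc, Finset.mem_erase]
        rintro ⟨h, h'⟩
        refine ⟨by omega, fun s hs => ?_⟩
        by_cases hsr : s = r
        · subst hsr
          omega
        · exact h' s ⟨hsr, hs⟩
      have h11 := Finset.card_le_card h10
      omega

/-! ## Neighbourhoods of sets of intervals -/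

namespace OverlappingAllDiff

variable {n d : ℕ} (I : OverlappingAllDiff n d)

theorem mem_nbhd_dom {Q : Finset (Fin n)} {x : ℕ} :
    x ∈ nbhd I.dom Q ↔ ∃ i ∈ Q, I.lb i ≤ x ∧ x ≤ I.ub i := by
  simp [nbhd, dom]

/-- At a gap `x` every domain lies entirely on one side, so cutting the set of variables at `x` cuts
its neighbourhood. With the three variants below, this drives the inductions that split at a gap. -/
theorem nbhd_filter_ub_lt {Q : Finset (Fin n)} {x : ℕ} (hx : ∀ i ∈ Q, I.ub i < x ∨ x < I.lb i) :
    nbhd I.dom (Q.filter fun i => I.ub i < x) = (nbhd I.dom Q).filter (· < x) := by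
  ext y
  simp only [mem_nbhd_dom, Finset.mem_filter]
  constructor
  · rintro ⟨i, ⟨hi, h⟩, h1, h2⟩
    exact ⟨⟨i, hi, h1, h2⟩, by omega⟩
  · rintro ⟨⟨i, hi, h1, h2⟩, h⟩
    exact ⟨i, ⟨hi, (hx i hi).resolve_right (by omega)⟩, h1, h2⟩

theorem nbhd_filter_not_ub_lt {Q : Finset (Fin n)} {x : ℕ}
    (hx : ∀ i ∈ Q, I.ub i < x ∨ x < I.lb i) :
    nbhd I.dom (Q.filter fun i => ¬ I.ub i < x) = (nbhd I.dom Q).filter (¬ · < x) := by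
  ext y
  simp only [mem_nbhd_dom, Finset.mem_filter]
  constructor
  · rintro ⟨i, ⟨hi, h⟩, h1, h2⟩
    exact ⟨⟨i, hi, h1, h2⟩, by have := hx i hi; omega⟩
  · rintro ⟨⟨i, hi, h1, h2⟩, h⟩
    exact ⟨i, ⟨hi, by omega⟩, h1, h2⟩

theorem commonNbhd_filter_ub_lt {Q : Finset (Fin n)} {x : ℕ}
    (hx : ∀ i ∈ Q, I.ub i < x ∨ x < I.lb i) :
    commonNbhd I.dom I.S I.T (Q.filter fun i => I.ub i < x) =
      (commonNbhd I.dom I.S I.T Q).filter (· < x) := by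
  simp only [commonNbhd, Finset.filter_inter,
    nbhd_filter_ub_lt I fun i hi => hx i (Finset.mem_of_mem_inter_left hi)]
  ext y
  simp only [Finset.mem_inter, Finset.mem_filter]
  tauto

theorem commonNbhd_filter_not_ub_lt {Q : Finset (Fin n)} {x : ℕ}
    (hx : ∀ i ∈ Q, I.ub i < x ∨ x < I.lb i) :
    commonNbhd I.dom I.S I.T (Q.filter fun i => ¬ I.ub i < x) =
      (commonNbhd I.dom I.S I.T Q).filter (¬ · < x) := by
  simp only [commonNbhd, Finset.filter_inter,
    nbhd_filter_not_ub_lt I fun i hi => hx i (Finset.mem_of_mem_inter_left hi)]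
  ext y
  simp only [Finset.mem_inter, Finset.mem_filter]
  tauto

/-- The neighbourhood of a nonempty set of intervals is an interval or has a gap. -/
theorem nbhd_eq_Ioc_or_gap {Q : Finset (Fin n)} (hQ : Q.Nonempty) :
    (∃ a b, a < b ∧ nbhd I.dom Q = Finset.Ioc a b ∧ ∃ i ∈ Q, I.ub i = b) ∨
    ∃ x, (∀ i ∈ Q, I.ub i < x ∨ x < I.lb i) ∧ (∃ i ∈ Q, I.ub i < x) ∧ ∃ i ∈ Q, ¬ I.ub i < x := by
  obtain ⟨i, hi, hmin⟩ := Finset.exists_min_image Q I.lb hQ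
  obtain ⟨j, hj, hmax⟩ := Finset.exists_max_image Q I.ub hQ
  have hi1 := I.one_le_lb i
  have hi2 := I.lb_le_ub i
  have hij := hmax i hi
  by_cases h : ∃ x, I.lb i ≤ x ∧ x ≤ I.ub j ∧ x ∉ nbhd I.dom Q
  · right
    obtain ⟨x, h1, h2, h3⟩ := h
    have h4 : ∀ i ∈ Q, I.ub i < x ∨ x < I.lb i := by
      intro k hk
      by_contra hc
      exact h3 ((mem_nbhd_dom I).2 ⟨k, hk, by omega, by omega⟩)
    exact ⟨x, h4, ⟨i, hi, (h4 i hi).resolve_right (by omega)⟩, j, hj, by omega⟩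
  · left
    push Not at h
    -- Intervals are open on the left, so the left node is one below the least lower bound.
    refine ⟨I.lb i - 1, I.ub j, by omega, ?_, j, hj, rfl⟩
    ext x
    rw [Finset.mem_Ioc]
    constructor
    · intro hx
      obtain ⟨k, hk, h1, h2⟩ := (mem_nbhd_dom I).1 hx
      have := hmin k hk
      have := hmax k hk
      omega
    · intro hx
      exact h x (by omega) (by omega)

/-- The number of variables of `Q` with domain inside `(p, q]`. -/
def count (Q : Finset (Fin n)) (p q : ℕ) : ℕ :=
  (Q.filter fun i => p < I.lb i ∧ I.ub i ≤ q).card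

/-- The number of values of `(p, q]` that the variables of `Q` inside `(p, q]` leave over. -/
def slack (Q : Finset (Fin n)) (p q : ℕ) : ℕ :=
  q - p - I.count Q p q

theorem card_le_count {Q X : Finset (Fin n)} (hQX : Q ⊆ X) {a b : ℕ}
    (h : nbhd I.dom Q ⊆ Finset.Ioc a b) : Q.card ≤ I.count X a b := by
  refine Finset.card_le_card fun i hi => Finset.mem_filter.2 ⟨hQX hi, ?_⟩
  have h0 := I.lb_le_ub i
  have h1 := Finset.mem_Ioc.1 (h ((mem_nbhd_dom I).2 ⟨i, hi, le_rfl, h0⟩))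
  have h2 := Finset.mem_Ioc.1 (h ((mem_nbhd_dom I).2 ⟨i, hi, h0, le_rfl⟩))
  exact ⟨h1.1, h2.2⟩

/-- Decomposition of the neighbourhood of a set of intervals into its maximal runs. -/
theorem exists_runs {X : Finset (Fin n)} (hX : ∀ p ≤ d, ∀ q ≤ d, I.count X p q ≤ q - p)
    (Q : Finset (Fin n)) (hQ : Q ⊆ X) :
    ∃ R : Finset (ℕ × ℕ), (∀ r ∈ R, r.1 < r.2 ∧ ∃ i ∈ Q, I.ub i = r.2) ∧
      (∀ x, x ∈ nbhd I.dom Q ↔ ∃ r ∈ R, r.1 < x ∧ x ≤ r.2) ∧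
      (∀ r ∈ R, ∀ s ∈ R, ∀ x, r.1 < x → x ≤ r.2 → s.1 < x → x ≤ s.2 → r = s) ∧
      ∑ r ∈ R, I.slack X r.1 r.2 + Q.card ≤ (nbhd I.dom Q).card := by
  induction hm : Q.card using Nat.strong_induction_on generalizing Q with
  | _ m ih =>
    subst hm
    rcases Q.eq_empty_or_nonempty with rfl | hne
    · exact ⟨∅, by simp [nbhd]⟩
    rcases nbhd_eq_Ioc_or_gap I hne with ⟨a, b, hab, hN, i, hi, hib⟩ | ⟨x, hx, ⟨i, hi, hix⟩, j, hj, hjx⟩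
    · refine ⟨{(a, b)}, ?_, ?_, ?_, ?_⟩
      · simp only [Finset.mem_singleton, forall_eq]
        exact ⟨hab, i, hi, hib⟩
      · simp [hN]
      · simp only [Finset.mem_singleton]
        rintro r rfl s rfl
        simp
      -- All of `Q` is confined to the run `(a, b]`, and `hX` makes the truncated subtraction in
      -- `slack` exact.
      · have h1 := card_le_count I hQ hN.subset
        have hbd : b ≤ d := hib ▸ I.ub_le i
        have h2 := hX a (by omega) b hbd
        simp only [Finset.sum_singleton, slack, hN, Nat.card_Ioc]
        omega
    · obtain ⟨R₁, h11, h12, h13, h14⟩ := ih (Q.filter fun i => I.ub i < x).card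
        (Finset.card_lt_card (Finset.filter_ssubset.2 ⟨j, hj, hjx⟩)) _
        ((Finset.filter_subset _ _).trans hQ) rfl
      obtain ⟨R₂, h21, h22, h23, h24⟩ := ih (Q.filter fun i => ¬ I.ub i < x).card
        (Finset.card_lt_card (Finset.filter_ssubset.2 ⟨i, hi, by simpa using hix⟩)) _
        ((Finset.filter_subset _ _).trans hQ) rfl
      rw [nbhd_filter_ub_lt I hx] at h12 h14
      rw [nbhd_filter_not_ub_lt I hx] at h22 h24
      have k1 : ∀ r ∈ R₁, ∀ y, r.1 < y → y ≤ r.2 → y < x := fun r hr y hy hy' =>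
        (Finset.mem_filter.1 ((h12 y).2 ⟨r, hr, hy, hy'⟩)).2
      have k2 : ∀ r ∈ R₂, ∀ y, r.1 < y → y ≤ r.2 → ¬ y < x := fun r hr y hy hy' =>
        (Finset.mem_filter.1 ((h22 y).2 ⟨r, hr, hy, hy'⟩)).2
      refine ⟨R₁ ∪ R₂, ?_, ?_, ?_, ?_⟩
      · intro r hr
        rcases Finset.mem_union.1 hr with hr | hr
        · obtain ⟨h, k, hk, hk'⟩ := h11 r hr
          exact ⟨h, k, Finset.mem_of_mem_filter k hk, hk'⟩
        · obtain ⟨h, k, hk, hk'⟩ := h21 r hr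
          exact ⟨h, k, Finset.mem_of_mem_filter k hk, hk'⟩
      · intro y
        have h1 := h12 y
        have h2 := h22 y
        simp only [Finset.mem_filter] at h1 h2
        simp only [Finset.mem_union, or_and_right, exists_or, ← h1, ← h2]
        tauto
      · intro r hr s hs y hy1 hy2 hy3 hy4
        rcases Finset.mem_union.1 hr with hr | hr <;> rcases Finset.mem_union.1 hs with hs | hs
        · exact h13 r hr s hs y hy1 hy2 hy3 hy4
        · exact absurd (k1 r hr y hy1 hy2) (k2 s hs y hy3 hy4)
        · exact absurd (k1 s hs y hy3 hy4) (k2 r hr y hy1 hy2)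
        · exact h23 r hr s hs y hy1 hy2 hy3 hy4
      · have hdisj : Disjoint R₁ R₂ := by
          rw [Finset.disjoint_left]
          intro r hr hr'
          have h := (h11 r hr).1
          exact k2 r hr' r.2 h le_rfl (k1 r hr r.2 h le_rfl)
        rw [Finset.sum_union hdisj]
        have h1 := Finset.card_filter_add_card_filter_not (s := Q) (fun i => I.ub i < x)
        have h2 := Finset.card_filter_add_card_filter_not (s := nbhd I.dom Q) (fun y => y < x)
        omega

end OverlappingAllDiff

namespace OverlappingAllDiff

variable {n d : ℕ} (I : OverlappingAllDiff n d)

/-! ## The exclusion test -/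

/-- The least cost of covering `(p, q]` by intervals, each paying its slack for `S \ T` or for
`T \ S`. -/
def dist : ℕ → ℕ → ℕ :=
  relax (fun p q => min (I.slack (I.S \ I.T) p q) (I.slack (I.T \ I.S) p q)) (d + 1)

/-- The least cost of reaching `y` from `l` when the last interval is paid by `Q` and starts at `w` or
before. -/
def reach (Q : Finset (Fin n)) (w l y : ℕ) : ℕ :=
  -- The starting value repeats the candidate `p = 0`: it must itself be the cost of a genuine
  -- choice for the lower bounds to hold.
  runMin (I.dist l 0 + I.slack Q 0 y) (fun p => I.dist l p + I.slack Q p y) (w + 1)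

/-- The least cost of reaching from `l` some node beyond `w` when the last interval is paid by `Q` and
contains `w + 1`. -/
def reachPast (Q : Finset (Fin n)) (w l : ℕ) : ℕ :=
  -- The clamp by `w + 1` turns nodes that are not beyond `w` into admissible ones, so no test is
  -- needed in the loop.
  runMin (I.reach Q w l d) (fun y => I.reach Q w l (max y (w + 1))) (d + 1)

/-- The least cost of reaching `y` from `l` with `w + 1` in an interval paid by `S \ T` and in one paid
by `T \ S`, the last two intervals used. -/
def reachTwice (w l y : ℕ) : ℕ :=
  -- Four cases: which interval starts first and which ends last. If it is the same one, it joins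
  -- `l` to `y` and the other only has to contain `w + 1`. Otherwise the first is joined to `l` and
  -- the last ends at `y`. An interval whose start is free is looked up in row `d`, as `dist d p =
  -- 0` for all `p ≤ d`.
  min (min (I.reach (I.S \ I.T) w l y + I.reachPast (I.T \ I.S) w d)
      (I.reach (I.T \ I.S) w l y + I.reachPast (I.S \ I.T) w d))
    (min (I.reachPast (I.S \ I.T) w l + I.reach (I.T \ I.S) w d y)
      (I.reachPast (I.T \ I.S) w l + I.reach (I.S \ I.T) w d y))

/-- The least cost of covering `(l, u]` with `w + 1` in an interval paid by `S \ T` and in one paid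
by `T \ S`. -/
def coverCost (w l u : ℕ) : ℕ :=
  -- Only upper bounds of variables are tried as end points: `n` candidates keep the total at `n
  -- d³`, whereas trying all nodes would cost `d⁴`.
  runMin (I.reachTwice w l d + I.dist d u)
    (fun i => I.reachTwice w l (max (arrayOf I.ub i) (w + 1)) +
      I.dist (max (arrayOf I.ub i) (w + 1)) u) n

/-- No interval is overfull. -/
def Consistent : Prop :=
  ∀ p ≤ d, ∀ q ≤ d, I.count (I.S \ I.T) p q ≤ q - p ∧ I.count (I.T \ I.S) p q ≤ q - p ∧
    I.count (I.S ∩ I.T) p q ≤ I.dist p q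

/-- Some interval would be overfull if the value `w + 1` were given to the variable `i`. -/
def Excluded (w : ℕ) (i : Fin n) : Prop :=
  ∃ l ≤ d, ∃ u ≤ d, I.coverCost w l u + (if l < I.lb i ∧ I.ub i ≤ u then 1 else 0) ≤
    1 + I.count (I.S ∩ I.T) l u

theorem dist_triangle (p q : ℕ) {r : ℕ} (hr : r ≤ d) : I.dist p q ≤ I.dist p r + I.dist r q :=
  relax_triangle _ (by omega) p q

theorem dist_le_slack_left (p q : ℕ) : I.dist p q ≤ I.slack (I.S \ I.T) p q :=
  (relax_le _ _ _ _).trans (min_le_left _ _)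

theorem dist_le_slack_right (p q : ℕ) : I.dist p q ≤ I.slack (I.T \ I.S) p q :=
  (relax_le _ _ _ _).trans (min_le_right _ _)

theorem dist_le_sub (p q : ℕ) : I.dist p q ≤ q - p :=
  (I.dist_le_slack_left p q).trans (Nat.sub_le _ _)

/-- Going backwards is free, which lets covering intervals overlap and overshoot. -/
theorem dist_eq_zero {p q : ℕ} (h : q ≤ p) : I.dist p q = 0 := by
  have := I.dist_le_sub p q
  omega

theorem reach_le (Q : Finset (Fin n)) {w p : ℕ} (l y : ℕ) (hp : p ≤ w) :
    I.reach Q w l y ≤ I.dist l p + I.slack Q p y :=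
  runMin_le (f := fun p => I.dist l p + I.slack Q p y) (by omega)

theorem reachPast_le (Q : Finset (Fin n)) {w p y : ℕ} (l : ℕ) (hp : p ≤ w) (hw : w < y) (hy : y ≤ d) :
    I.reachPast Q w l ≤ I.dist l p + I.slack Q p y := by
  have h : I.reachPast Q w l ≤ I.reach Q w l (max y (w + 1)) :=
    runMin_le (f := fun y => I.reach Q w l (max y (w + 1))) (by omega)
  rw [max_eq_left (by omega)] at h
  exact h.trans (I.reach_le Q l y hp)

/-! ### Completeness -/

theorem card_eq_card_parts (P : Finset (Fin n)) :
    P.card = (P ∩ (I.S \ I.T)).card + (P ∩ (I.T \ I.S)).card + (P ∩ (I.S ∩ I.T)).card := by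
  have h1 : P = (P ∩ (I.S \ I.T) ∪ P ∩ (I.T \ I.S)) ∪ P ∩ (I.S ∩ I.T) := by
    ext i
    have : i ∈ I.S ∪ I.T := I.cover ▸ Finset.mem_univ i
    simp only [Finset.mem_union, Finset.mem_inter, Finset.mem_sdiff] at this ⊢
    tauto
  conv_lhs => rw [h1]
  rw [Finset.card_union_of_disjoint, Finset.card_union_of_disjoint]
  · rw [Finset.disjoint_left]
    intro i
    simp only [Finset.mem_inter, Finset.mem_sdiff]
    tauto
  · rw [Finset.disjoint_left]
    intro i
    simp only [Finset.mem_union, Finset.mem_inter, Finset.mem_sdiff]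
    tauto

theorem nbhd_mono {P Q : Finset (Fin n)} (h : P ⊆ Q) : nbhd I.dom P ⊆ nbhd I.dom Q :=
  Finset.biUnion_subset_biUnion_of_subset_left _ h

/-- Covering data for a set of variables: the runs of its two one-sided neighbourhoods, tagged by
the side they belong to, and what they cost. -/
theorem exists_tagged_runs (hc : I.Consistent) (P : Finset (Fin n)) {l u : ℕ}
    (hN : nbhd I.dom P = Finset.Ioc l u) :
    ∃ RS RT : Finset (ℕ × ℕ),
      (∀ r ∈ RS, r.1 < r.2 ∧ ∃ i ∈ P, I.ub i = r.2) ∧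
      (∀ r ∈ RT, r.1 < r.2 ∧ ∃ i ∈ P, I.ub i = r.2) ∧
      (∀ r ∈ RS, ∀ s ∈ RS, ∀ x, r.1 < x → x ≤ r.2 → s.1 < x → x ≤ s.2 → r = s) ∧
      (∀ r ∈ RT, ∀ s ∈ RT, ∀ x, r.1 < x → x ≤ r.2 → s.1 < x → x ≤ s.2 → r = s) ∧
      (∀ x, x ∈ commonNbhd I.dom I.S I.T P ↔
        (∃ r ∈ RS, r.1 < x ∧ x ≤ r.2) ∧ ∃ r ∈ RT, r.1 < x ∧ x ≤ r.2) ∧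
      ((Finset.Ioc l u).filter fun x =>
          ∀ r ∈ RS.disjSum RT, ¬ ((r.elim Prod.fst Prod.fst) < x ∧ x ≤ r.elim Prod.snd Prod.snd)).card +
        ∑ r ∈ RS.disjSum RT, r.elim (fun r => I.slack (I.S \ I.T) r.1 r.2)
          (fun r => I.slack (I.T \ I.S) r.1 r.2) + P.card ≤
        (nbhd I.dom P).card + (commonNbhd I.dom I.S I.T P).card + (P ∩ (I.S ∩ I.T)).card := by
  obtain ⟨RS, s1, s2, s3, s4⟩ := I.exists_runs (X := I.S \ I.T)
    (fun p hp q hq => (hc p hp q hq).1) (P ∩ (I.S \ I.T)) Finset.inter_subset_right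
  obtain ⟨RT, t1, t2, t3, t4⟩ := I.exists_runs (X := I.T \ I.S)
    (fun p hp q hq => (hc p hp q hq).2.1) (P ∩ (I.T \ I.S)) Finset.inter_subset_right
  refine ⟨RS, RT, fun r hr => ?_, fun r hr => ?_, s3, t3, fun x => ?_, ?_⟩
  · obtain ⟨h, i, hi, hi'⟩ := s1 r hr
    exact ⟨h, i, Finset.mem_of_mem_inter_left hi, hi'⟩
  · obtain ⟨h, i, hi, hi'⟩ := t1 r hr
    exact ⟨h, i, Finset.mem_of_mem_inter_left hi, hi'⟩
  · rw [commonNbhd, Finset.mem_inter, s2, t2]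
  · rw [Finset.sum_disjSum]
    simp only [Sum.elim_inl, Sum.elim_inr]
    have h1 := I.card_eq_card_parts P
    -- Inclusion-exclusion trades the two one-sided neighbourhoods for their union and the common
    -- part; the union and the missed points fit disjointly into `nbhd I.dom P`.
    have h2 := Finset.card_union_add_card_inter (nbhd I.dom (P ∩ (I.S \ I.T)))
      (nbhd I.dom (P ∩ (I.T \ I.S)))
    have h3 : ((Finset.Ioc l u).filter fun x => ∀ r ∈ RS.disjSum RT,
        ¬ ((r.elim Prod.fst Prod.fst) < x ∧ x ≤ r.elim Prod.snd Prod.snd)) ⊆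
        nbhd I.dom P \ (nbhd I.dom (P ∩ (I.S \ I.T)) ∪ nbhd I.dom (P ∩ (I.T \ I.S))) := by
      intro x hx
      rw [Finset.mem_filter, ← hN] at hx
      rw [Finset.mem_sdiff, Finset.mem_union, s2, t2]
      refine ⟨hx.1, ?_⟩
      rintro (⟨r, hr, h⟩ | ⟨r, hr, h⟩)
      · exact hx.2 (Sum.inl r) (Finset.inl_mem_disjSum.2 hr) h
      · exact hx.2 (Sum.inr r) (Finset.inr_mem_disjSum.2 hr) h
    have h4 := Finset.card_le_card h3
    have h5 : nbhd I.dom (P ∩ (I.S \ I.T)) ∪ nbhd I.dom (P ∩ (I.T \ I.S)) ⊆ nbhd I.dom P :=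
      Finset.union_subset (I.nbhd_mono Finset.inter_subset_left)
        (I.nbhd_mono Finset.inter_subset_left)
    have h6 := Finset.card_sdiff_add_card_eq_card h5
    have h7 : (commonNbhd I.dom I.S I.T P).card =
      (nbhd I.dom (P ∩ (I.S \ I.T)) ∩ nbhd I.dom (P ∩ (I.T \ I.S))).card := rfl
    omega

theorem le_of_mem_nbhd (P : Finset (Fin n)) {x : ℕ} (hx : x ∈ nbhd I.dom P) : x ≤ d := by
  obtain ⟨i, -, -, h⟩ := (I.mem_nbhd_dom).1 hx
  exact h.trans (I.ub_le i)

/-- The Hall condition for simultaneous matchings. -/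
theorem card_le_nbhd_add_commonNbhd (hc : I.Consistent) (P : Finset (Fin n)) :
    P.card ≤ (nbhd I.dom P).card + (commonNbhd I.dom I.S I.T P).card := by
  induction hm : P.card using Nat.strong_induction_on generalizing P with
  | _ m ih =>
    subst hm
    rcases P.eq_empty_or_nonempty with rfl | hne
    · simp
    rcases I.nbhd_eq_Ioc_or_gap hne with ⟨l, u, hlu, hN, -⟩ | ⟨x, hx, ⟨i, hi, hix⟩, j, hj, hjx⟩
    · have hu : u ≤ d := I.le_of_mem_nbhd P (hN ▸ Finset.mem_Ioc.2 ⟨hlu, le_rfl⟩)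
      obtain ⟨RS, RT, s1, t1, -, -, -, h⟩ := I.exists_tagged_runs hc P hN
      have h1 := dist_le_uncovered_add_sum I.dist_le_sub (fun p q r hr => I.dist_triangle p q hr)
        (fun r : (ℕ × ℕ) ⊕ (ℕ × ℕ) => r.elim Prod.fst Prod.fst) (fun r => r.elim Prod.snd Prod.snd)
        (fun r => r.elim (fun r => I.slack (I.S \ I.T) r.1 r.2)
          (fun r => I.slack (I.T \ I.S) r.1 r.2)) l u (RS.disjSum RT) (by
            rintro (r | r) hr
            · obtain ⟨h1, i, -, h2⟩ := s1 r (Finset.inl_mem_disjSum.1 hr)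
              exact ⟨h1, h2.ge.trans (I.ub_le i), I.dist_le_slack_left _ _⟩
            · obtain ⟨h1, i, -, h2⟩ := t1 r (Finset.inr_mem_disjSum.1 hr)
              exact ⟨h1, h2.ge.trans (I.ub_le i), I.dist_le_slack_right _ _⟩) hu
      -- The cover bounds `dist l u` from above, and consistency bounds it from below by the number
      -- of confined variables of `S ∩ T`.
      have h2 := (hc l (by omega) u hu).2.2
      have h3 := I.card_le_count (Q := P ∩ (I.S ∩ I.T)) Finset.inter_subset_right
        (hN ▸ I.nbhd_mono Finset.inter_subset_left)
      omega
    · have h1 := ih (P.filter fun i => I.ub i < x).card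
        (Finset.card_lt_card (Finset.filter_ssubset.2 ⟨j, hj, hjx⟩)) _ rfl
      have h2 := ih (P.filter fun i => ¬ I.ub i < x).card
        (Finset.card_lt_card (Finset.filter_ssubset.2 ⟨i, hi, by simpa using hix⟩)) _ rfl
      rw [nbhd_filter_ub_lt I hx, commonNbhd_filter_ub_lt I hx] at h1
      rw [nbhd_filter_not_ub_lt I hx, commonNbhd_filter_not_ub_lt I hx] at h2
      have h3 := Finset.card_filter_add_card_filter_not (s := P) (fun i => I.ub i < x)
      have h4 := Finset.card_filter_add_card_filter_not (s := nbhd I.dom P) (fun y => y < x)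
      have h5 := Finset.card_filter_add_card_filter_not (s := commonNbhd I.dom I.S I.T P)
        (fun y => y < x)
      omega

/-- A set of variables can be cut down to the run of its neighbourhood that contains a given value. -/
theorem exists_subset_nbhd_eq_Ioc (hc : I.Consistent) (P : Finset (Fin n)) {v : ℕ}
    (hv : v ∈ commonNbhd I.dom I.S I.T P) {k : ℕ}
    (hP : (nbhd I.dom P).card + (commonNbhd I.dom I.S I.T P).card ≤ P.card + k) :
    ∃ Q ⊆ P, ∃ l u, l < u ∧ nbhd I.dom Q = Finset.Ioc l u ∧ v ∈ commonNbhd I.dom I.S I.T Q ∧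
      (nbhd I.dom Q).card + (commonNbhd I.dom I.S I.T Q).card ≤ Q.card + k := by
  induction hm : P.card using Nat.strong_induction_on generalizing P with
  | _ m ih =>
    subst hm
    rcases P.eq_empty_or_nonempty with rfl | hne
    · simp [commonNbhd, nbhd] at hv
    rcases I.nbhd_eq_Ioc_or_gap hne with ⟨l, u, hlu, hN, -⟩ | ⟨x, hx, ⟨i, hi, hix⟩, j, hj, hjx⟩
    · exact ⟨P, subset_rfl, l, u, hlu, hN, hv, hP⟩
    -- Excess is additive over the two sides of the gap and nonnegative on each, so the side that
    -- contains `v` inherits the bound `k`.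
    · have e1 := I.card_le_nbhd_add_commonNbhd hc (P.filter fun i => I.ub i < x)
      have e2 := I.card_le_nbhd_add_commonNbhd hc (P.filter fun i => ¬ I.ub i < x)
      have h1 := ih (P.filter fun i => I.ub i < x).card
        (Finset.card_lt_card (Finset.filter_ssubset.2 ⟨j, hj, hjx⟩)) (P.filter fun i => I.ub i < x)
      have h2 := ih (P.filter fun i => ¬ I.ub i < x).card
        (Finset.card_lt_card (Finset.filter_ssubset.2 ⟨i, hi, by simpa using hix⟩))
        (P.filter fun i => ¬ I.ub i < x)
      rw [nbhd_filter_ub_lt I hx, commonNbhd_filter_ub_lt I hx] at e1 h1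
      rw [nbhd_filter_not_ub_lt I hx, commonNbhd_filter_not_ub_lt I hx] at e2 h2
      have h3 := Finset.card_filter_add_card_filter_not (s := P) (fun i => I.ub i < x)
      have h4 := Finset.card_filter_add_card_filter_not (s := nbhd I.dom P) (fun y => y < x)
      have h5 := Finset.card_filter_add_card_filter_not (s := commonNbhd I.dom I.S I.T P)
        (fun y => y < x)
      by_cases hvx : v < x
      · obtain ⟨Q, hQ, h⟩ := h1 (Finset.mem_filter.2 ⟨hv, hvx⟩) (by omega) rfl
        exact ⟨Q, hQ.trans (Finset.filter_subset _ _), h⟩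
      · obtain ⟨Q, hQ, h⟩ := h2 (Finset.mem_filter.2 ⟨hv, hvx⟩) (by omega) rfl
        exact ⟨Q, hQ.trans (Finset.filter_subset _ _), h⟩

/-- The orders of the left ends and of the right ends select one of the four terms of `reachTwice`;
`z1` and `z2` make the free start at `d` cost nothing. -/
theorem reachTwice_le {w a b a' b' : ℕ} (l : ℕ) (ha : a ≤ w) (hb : w < b) (hbd : b ≤ d)
    (ha' : a' ≤ w) (hb' : w < b') (hbd' : b' ≤ d) :
    I.reachTwice w l (max b b') ≤ I.dist l (min a a') + I.slack (I.S \ I.T) a b +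
      I.slack (I.T \ I.S) a' b' := by
  have z1 := I.dist_eq_zero (p := d) (q := a) (by omega)
  have z2 := I.dist_eq_zero (p := d) (q := a') (by omega)
  have s1 := I.reach_le (I.S \ I.T) l b ha
  have s2 := I.reach_le (I.S \ I.T) d b ha
  have s3 := I.reachPast_le (I.S \ I.T) l ha hb hbd
  have s4 := I.reachPast_le (I.S \ I.T) d ha hb hbd
  have t1 := I.reach_le (I.T \ I.S) l b' ha'
  have t2 := I.reach_le (I.T \ I.S) d b' ha'
  have t3 := I.reachPast_le (I.T \ I.S) l ha' hb' hbd'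
  have t4 := I.reachPast_le (I.T \ I.S) d ha' hb' hbd'
  unfold reachTwice
  rcases le_total a a' with h | h <;> rcases le_total b b' with h' | h' <;>
    simp only [h, h', min_eq_left, min_eq_right, max_eq_left, max_eq_right] <;> omega

/-- The two runs through `w + 1` are fed to `reachTwice`; the remaining runs and the missed points
pay for `dist` from `l` to the first of their left ends and from the last of their right ends to
`u`. -/
theorem excluded_of_isAlmostSimHallSet (hc : I.Consistent) {P : Finset (Fin n)}
    (hP : IsAlmostSimHallSet I.dom I.S I.T P) {i : Fin n} (hi : i ∈ (I.S ∩ I.T) \ P) {w : ℕ}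
    (hw : w + 1 ∈ commonNbhd I.dom I.S I.T P) : I.Excluded w i := by
  obtain ⟨Q, hQ, l, u, hlu, hN, hwQ, hQ1⟩ := I.exists_subset_nbhd_eq_Ioc hc P hw (k := 1)
    (le_of_eq hP)
  have hu : u ≤ d := I.le_of_mem_nbhd Q (hN ▸ Finset.mem_Ioc.2 ⟨hlu, le_rfl⟩)
  refine ⟨l, by omega, u, hu, ?_⟩
  obtain ⟨RS, RT, s1, t1, s2, t2, h0, h⟩ := I.exists_tagged_runs hc Q hN
  obtain ⟨⟨⟨a, b⟩, hr, hr1, hr2⟩, ⟨a', b'⟩, hs, hs1, hs2⟩ := (h0 _).1 hwQ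
  dsimp only at hr1 hr2 hs1 hs2
  obtain ⟨-, j, hjQ, hj⟩ := s1 _ hr
  obtain ⟨-, j', hjQ', hj'⟩ := t1 _ hs
  dsimp only at hj hj'
  have hbd : b ≤ d := hj ▸ I.ub_le j
  have hbd' : b' ≤ d := hj' ▸ I.ub_le j'
  -- Since `i ∉ Q`, a confined `i` is counted on the right in addition to the variables of `Q`.
  have hcount : (Q ∩ (I.S ∩ I.T)).card + (if l < I.lb i ∧ I.ub i ≤ u then 1 else 0) ≤
      I.count (I.S ∩ I.T) l u := by
    have k1 := I.card_le_count (Q := Q ∩ (I.S ∩ I.T)) (X := (I.S ∩ I.T).erase i) (fun k hk => by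
        rw [Finset.mem_erase]
        refine ⟨?_, Finset.mem_of_mem_inter_right hk⟩
        rintro rfl
        exact (Finset.mem_sdiff.1 hi).2 (hQ (Finset.mem_of_mem_inter_left hk)))
      (hN ▸ I.nbhd_mono Finset.inter_subset_left)
    refine (Nat.add_le_add_right k1 _).trans ?_
    unfold count
    rw [Finset.filter_erase]
    split_ifs with hlu'
    · exact (Finset.card_erase_add_one
        (Finset.mem_filter.2 ⟨(Finset.mem_sdiff.1 hi).1, hlu'⟩)).le
    · exact Finset.card_erase_le
  -- Each of `b`, `b'` is the upper bound of a variable, hence so is the larger one, a candidate in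
  -- `coverCost`.
  have hcover : I.coverCost w l u ≤ I.reachTwice w l (max b b') + I.dist (max b b') u := by
    have key : ∀ j : Fin n, w < I.ub j →
        I.coverCost w l u ≤ I.reachTwice w l (I.ub j) + I.dist (I.ub j) u := by
      intro j hj
      have h1 : I.coverCost w l u ≤ I.reachTwice w l (max (arrayOf I.ub j) (w + 1)) +
          I.dist (max (arrayOf I.ub j) (w + 1)) u :=
        runMin_le (f := fun i => I.reachTwice w l (max (arrayOf I.ub i) (w + 1)) +
          I.dist (max (arrayOf I.ub i) (w + 1)) u) j.2
      have h2 : arrayOf I.ub j = I.ub j := by simp [arrayOf]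
      rwa [h2, max_eq_left hj] at h1
    rcases le_total b b' with hbb | hbb
    · rw [max_eq_right hbb, ← hj']
      exact key j' (by omega)
    · rw [max_eq_left hbb, ← hj]
      exact key j (by omega)
  have htwice := I.reachTwice_le (w := w) (a := a) (b := b) (a' := a') (b' := b') l (by omega)
    (by omega) hbd (by omega) (by omega) hbd'
  have hF : ∀ r ∈ RS.disjSum RT, r.elim Prod.fst Prod.fst < r.elim Prod.snd Prod.snd ∧
      r.elim Prod.snd Prod.snd ≤ d ∧ I.dist (r.elim Prod.fst Prod.fst) (r.elim Prod.snd Prod.snd) ≤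
      r.elim (fun r => I.slack (I.S \ I.T) r.1 r.2) (fun r => I.slack (I.T \ I.S) r.1 r.2) := by
    rintro (r | r) hr
    · obtain ⟨h1, i, -, h2⟩ := s1 r (Finset.inl_mem_disjSum.1 hr)
      exact ⟨h1, h2.ge.trans (I.ub_le i), I.dist_le_slack_left _ _⟩
    · obtain ⟨h1, i, -, h2⟩ := t1 r (Finset.inr_mem_disjSum.1 hr)
      exact ⟨h1, h2.ge.trans (I.ub_le i), I.dist_le_slack_right _ _⟩
  have huniq : ∀ r ∈ RS.disjSum RT, r.elim Prod.fst Prod.fst < w + 1 →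
      w + 1 ≤ r.elim Prod.snd Prod.snd → r = Sum.inl (a, b) ∨ r = Sum.inr (a', b') := by
    rintro (r | r) hr' h1 h2
    · exact Or.inl (congrArg _ (s2 r (Finset.inl_mem_disjSum.1 hr') _ hr _ h1 h2 hr1 hr2))
    · exact Or.inr (congrArg _ (t2 r (Finset.inr_mem_disjSum.1 hr') _ hs _ h1 h2 hs1 hs2))
  set F := RS.disjSum RT with hFdef
  set lo : (ℕ × ℕ) ⊕ (ℕ × ℕ) → ℕ := fun r => r.elim Prod.fst Prod.fst with hlo
  set hi' : (ℕ × ℕ) ⊕ (ℕ × ℕ) → ℕ := fun r => r.elim Prod.snd Prod.snd with hhi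
  set c : (ℕ × ℕ) ⊕ (ℕ × ℕ) → ℕ := fun r => r.elim (fun r => I.slack (I.S \ I.T) r.1 r.2)
    (fun r => I.slack (I.T \ I.S) r.1 r.2) with hcdef
  set x := min a a' with hx
  set y := max b b' with hy
  have hrF : Sum.inl (a, b) ∈ F := Finset.inl_mem_disjSum.2 hr
  have hsF : Sum.inr (a', b') ∈ F := Finset.inr_mem_disjSum.2 hs
  have d1 := dist_le_uncovered_add_sum I.dist_le_sub (fun p q r hr => I.dist_triangle p q hr)
    lo hi' c l x (F.filter fun r => lo r < x) (fun r hr => hF r (Finset.mem_of_mem_filter r hr))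
    (by omega)
  have d2 := dist_le_uncovered_add_sum I.dist_le_sub (fun p q r hr => I.dist_triangle p q hr)
    lo hi' c y u (F.filter fun r => y < hi' r) (fun r hr => hF r (Finset.mem_of_mem_filter r hr)) hu
  -- A run in both families would start before `x` and end after `y`, hence contain `w + 1`; but the
  -- only two such runs start at `x` or later.
  have hdisj : Disjoint (F.filter fun r => lo r < x) (F.filter fun r => y < hi' r) := by
    rw [Finset.disjoint_left]
    intro r h1 h2
    rw [Finset.mem_filter] at h1 h2
    rcases huniq r h1.1 (by change lo r < _; omega) (by change _ ≤ hi' r; omega) with rfl | rfl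
    · have : lo (Sum.inl (a, b)) = a := rfl
      omega
    · have : lo (Sum.inr (a', b')) = a' := rfl
      omega
  have hsub : insert (Sum.inl (a, b)) (insert (Sum.inr (a', b'))
      ((F.filter fun r => lo r < x) ∪ (F.filter fun r => y < hi' r))) ⊆ F := by
    intro r
    simp only [Finset.mem_insert, Finset.mem_union, Finset.mem_filter]
    rintro (rfl | rfl | h | h)
    exacts [hrF, hsF, h.1, h.1]
  have hsum := Finset.sum_le_sum_of_subset (f := c) hsub
  have e1 : lo (Sum.inl (a, b)) = a := rfl
  have e2 : lo (Sum.inr (a', b')) = a' := rfl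
  have e3 : hi' (Sum.inl (a, b)) = b := rfl
  have e4 : hi' (Sum.inr (a', b')) = b' := rfl
  rw [Finset.sum_insert (by simp [e1, e3]; omega), Finset.sum_insert (by simp [e2, e4]; omega),
    Finset.sum_union hdisj] at hsum
  have e5 : c (Sum.inl (a, b)) = I.slack (I.S \ I.T) a b := rfl
  have e6 : c (Sum.inr (a', b')) = I.slack (I.T \ I.S) a' b' := rfl
  -- A run covering a point of `(l, x]` starts before `x`, and one covering a point of `(y, u]` ends
  -- after `y`. So points missed by the subfamilies are missed by all of `F`.
  have hpts : ((Finset.Ioc l x).filter fun z => ∀ r ∈ F.filter fun r => lo r < x,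
        ¬ (lo r < z ∧ z ≤ hi' r)).card +
      ((Finset.Ioc y u).filter fun z => ∀ r ∈ F.filter fun r => y < hi' r,
        ¬ (lo r < z ∧ z ≤ hi' r)).card ≤
      ((Finset.Ioc l u).filter fun z => ∀ r ∈ F, ¬ (lo r < z ∧ z ≤ hi' r)).card := by
    have hyu : y ≤ u := by
      have h1 : b ∈ Finset.Ioc l u := hN ▸ I.mem_nbhd_dom.2 ⟨j, hjQ, hj ▸ I.lb_le_ub j, hj.ge⟩
      have h2 : b' ∈ Finset.Ioc l u := hN ▸ I.mem_nbhd_dom.2 ⟨j', hjQ', hj' ▸ I.lb_le_ub j', hj'.ge⟩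
      rw [Finset.mem_Ioc] at h1 h2
      omega
    rw [← Finset.card_union_of_disjoint]
    · refine Finset.card_le_card fun z => ?_
      simp only [Finset.mem_union, Finset.mem_filter, Finset.mem_Ioc]
      rintro (⟨h1, h2⟩ | ⟨h1, h2⟩)
      · exact ⟨by omega, fun r hr hz => h2 r ⟨hr, by omega⟩ hz⟩
      · have hly : l ≤ y := by
          have h3 := Finset.mem_Ioc.1 (hN ▸ I.mem_nbhd_dom.2 ⟨j, hjQ, hj ▸ I.lb_le_ub j, hj.ge⟩ :
            b ∈ Finset.Ioc l u)
          omega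
        exact ⟨by omega, fun r hr hz => h2 r ⟨hr, by omega⟩ hz⟩
    · rw [Finset.disjoint_left]
      intro z
      simp only [Finset.mem_filter, Finset.mem_Ioc]
      omega
  change ((Finset.Ioc l u).filter fun z => ∀ r ∈ F, ¬ (lo r < z ∧ z ≤ hi' r)).card +
    ∑ r ∈ F, c r + _ ≤ _ at h
  omega

/-! ### Soundness -/

/-- Every variable lies in `S` or in `T`, so `M` is the graph of a function. -/
theorem exists_solution_of_isSimMatching {M : Finset (Fin n × ℕ)}
    (hM : IsSimMatching I.dom I.S I.T M) :
    ∃ f : Fin n → ℕ, (∀ i, f i ∈ I.dom i) ∧ Set.InjOn f I.S ∧ Set.InjOn f I.T ∧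
      ∀ e ∈ M, e.2 = f e.1 := by
  obtain ⟨h0, ⟨hS, hS'⟩, hT, hT'⟩ := hM
  have hex : ∀ i : Fin n, ∃ v, (i, v) ∈ M := by
    intro i
    have hi : i ∈ I.S ∪ I.T := I.cover ▸ Finset.mem_univ i
    rcases Finset.mem_union.1 hi with hi | hi
    · obtain ⟨⟨i', v⟩, ⟨he, rfl⟩, -⟩ := hS' i hi
      exact ⟨v, Finset.mem_of_mem_filter _ he⟩
    · obtain ⟨⟨i', v⟩, ⟨he, rfl⟩, -⟩ := hT' i hi
      exact ⟨v, Finset.mem_of_mem_filter _ he⟩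
  choose f hf using hex
  have inj : ∀ X : Finset (Fin n), (∀ e ∈ M.filter fun e => e.1 ∈ X, ∀ e' ∈ M.filter fun e => e.1 ∈ X,
      e ≠ e' → e.1 ≠ e'.1 ∧ e.2 ≠ e'.2) → Set.InjOn f X := by
    intro X hX i hi j hj hij
    by_contra hne
    exact (hX (i, f i) (Finset.mem_filter.2 ⟨hf i, hi⟩) (j, f j) (Finset.mem_filter.2 ⟨hf j, hj⟩)
      fun h => hne (congrArg Prod.fst h)).2 hij
  refine ⟨f, fun i => h0 _ (hf i), inj _ hS, inj _ hT, ?_⟩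
  rintro ⟨i, v⟩ he
  have hi : i ∈ I.S ∪ I.T := I.cover ▸ Finset.mem_univ i
  by_contra hne
  have hne' : (i, v) ≠ (i, f i) := fun h => hne (congrArg Prod.snd h)
  rcases Finset.mem_union.1 hi with hi | hi
  · exact (hS (i, v) (Finset.mem_filter.2 ⟨he, hi⟩) (i, f i) (Finset.mem_filter.2 ⟨hf i, hi⟩)
      hne').1 rfl
  · exact (hT (i, v) (Finset.mem_filter.2 ⟨he, hi⟩) (i, f i) (Finset.mem_filter.2 ⟨hf i, hi⟩)
      hne').1 rfl

/-- The number of variables of `Q` whose value lies in `(p, q]`. -/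
def valuesIn (f : Fin n → ℕ) (Q : Finset (Fin n)) (p q : ℕ) : ℕ :=
  (Q.filter fun i => p < f i ∧ f i ≤ q).card

variable {I}

theorem valuesIn_le_add (f : Fin n → ℕ) (Q : Finset (Fin n)) (p r q : ℕ) :
    valuesIn f Q p q ≤ valuesIn f Q p r + valuesIn f Q r q := by
  refine (Finset.card_le_card fun i => ?_).trans (Finset.card_union_le _ _)
  simp only [Finset.mem_union, Finset.mem_filter]
  intro h
  rcases le_or_gt (f i) r with h' | h'
  · exact Or.inl ⟨h.1, h.2.1, h'⟩
  · exact Or.inr ⟨h.1, h', h.2.2⟩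

theorem valuesIn_mono_right (f : Fin n → ℕ) (Q : Finset (Fin n)) (p : ℕ) {q q' : ℕ} (h : q ≤ q') :
    valuesIn f Q p q ≤ valuesIn f Q p q' := by
  refine Finset.card_le_card fun i => ?_
  simp only [Finset.mem_filter]
  exact fun h' => ⟨h'.1, h'.2.1, h'.2.2.trans h⟩

theorem count_le_valuesIn {f : Fin n → ℕ} (hf : ∀ i, f i ∈ I.dom i) (Q : Finset (Fin n)) (p q : ℕ) :
    I.count Q p q ≤ valuesIn f Q p q := by
  refine Finset.card_le_card fun i => ?_
  have := Finset.mem_Icc.1 (hf i)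
  simp only [Finset.mem_filter]
  exact fun h => ⟨h.1, by omega, by omega⟩

/-- Pigeonhole: confined variables take their values inside `(p, q]`, and `f` is injective on `Y ∪
Z`. -/
theorem valuesIn_add_count_le {f : Fin n → ℕ} (hf : ∀ i, f i ∈ I.dom i) {X Y Z : Finset (Fin n)}
    (hX : Set.InjOn f X) (hY : Y ⊆ X) (hZ : Z ⊆ X) (hYZ : Disjoint Y Z) (p q : ℕ) :
    valuesIn f Y p q + I.count Z p q ≤ q - p := by
  refine (Nat.add_le_add_left (count_le_valuesIn hf Z p q) _).trans ?_
  unfold valuesIn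
  rw [← Finset.card_union_of_disjoint (Finset.disjoint_filter_filter hYZ), ← Nat.card_Ioc]
  refine Finset.card_le_card_of_injOn f (fun i hi => ?_) (hX.mono fun i hi => ?_)
  · simp only [Finset.coe_union, Finset.coe_filter, Set.mem_union, Set.mem_ofPred_eq] at hi
    simp only [Finset.coe_Ioc, Set.mem_Ioc]
    tauto
  · simp only [Finset.coe_union, Finset.coe_filter, Set.mem_union, Set.mem_ofPred_eq] at hi
    rcases hi with h | h
    exacts [hY h.1, hZ h.1]

theorem valuesIn_le_slack_left {f : Fin n → ℕ} (hf : ∀ i, f i ∈ I.dom i) (hS : Set.InjOn f I.S)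
    (p q : ℕ) : valuesIn f (I.S ∩ I.T) p q ≤ I.slack (I.S \ I.T) p q := by
  have h := valuesIn_add_count_le hf hS (Y := I.S ∩ I.T) (Z := I.S \ I.T) Finset.inter_subset_left
    Finset.sdiff_subset (Finset.disjoint_left.2 fun i => by simp; tauto) p q
  unfold slack
  omega

theorem valuesIn_le_slack_right {f : Fin n → ℕ} (hf : ∀ i, f i ∈ I.dom i) (hT : Set.InjOn f I.T)
    (p q : ℕ) : valuesIn f (I.S ∩ I.T) p q ≤ I.slack (I.T \ I.S) p q := by
  have h := valuesIn_add_count_le hf hT (Y := I.S ∩ I.T) (Z := I.T \ I.S) Finset.inter_subset_right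
    Finset.sdiff_subset (Finset.disjoint_left.2 fun i => by simp; tauto) p q
  unfold slack
  omega

theorem valuesIn_le_dist {f : Fin n → ℕ} (hf : ∀ i, f i ∈ I.dom i) (hS : Set.InjOn f I.S)
    (hT : Set.InjOn f I.T) (p q : ℕ) : valuesIn f (I.S ∩ I.T) p q ≤ I.dist p q :=
  le_relax (fun p q => le_min (valuesIn_le_slack_left hf hS p q) (valuesIn_le_slack_right hf hT p q))
    (valuesIn_le_add f _) _ p q

theorem consistent_of_solution {f : Fin n → ℕ} (hf : ∀ i, f i ∈ I.dom i) (hS : Set.InjOn f I.S)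
    (hT : Set.InjOn f I.T) : I.Consistent := by
  intro p _ q _
  refine ⟨?_, ?_, (count_le_valuesIn hf _ p q).trans (valuesIn_le_dist hf hS hT p q)⟩
  · have := valuesIn_add_count_le hf hS (Finset.empty_subset _) Finset.sdiff_subset
      (Finset.disjoint_empty_left (I.S \ I.T)) p q
    omega
  · have := valuesIn_add_count_le hf hT (Finset.empty_subset _) Finset.sdiff_subset
      (Finset.disjoint_empty_left (I.T \ I.S)) p q
    omega

theorem valuesIn_erase_le (f : Fin n → ℕ) (Q : Finset (Fin n)) (i : Fin n) (p q : ℕ) :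
    valuesIn f (Q.erase i) p q ≤ valuesIn f Q p q :=
  Finset.card_le_card (Finset.filter_subset_filter _ (Finset.erase_subset _ _))

theorem valuesIn_erase_add_one {f : Fin n → ℕ} {Q : Finset (Fin n)} {i : Fin n} (hi : i ∈ Q)
    {p q : ℕ} (hp : p < f i) (hq : f i ≤ q) :
    valuesIn f (Q.erase i) p q + 1 = valuesIn f Q p q := by
  unfold valuesIn
  rw [Finset.filter_erase]
  exact Finset.card_erase_add_one (Finset.mem_filter.2 ⟨hi, hp, hq⟩)

/-- With `m` counting the variables of `S ∩ T` other than `i`, each of the two intervals through `f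
i` loses the value taken by `i`. Hence the cheapest cover costs at least `m l u + 2`, one more than
exclusion allows. -/
theorem not_excluded_of_solution {f : Fin n → ℕ} (hf : ∀ i, f i ∈ I.dom i) (hS : Set.InjOn f I.S)
    (hT : Set.InjOn f I.T) {i : Fin n} (hi : i ∈ I.S ∩ I.T) : ¬ I.Excluded (f i - 1) i := by
  rintro ⟨l, -, u, -, h⟩
  have hi1 := Finset.mem_Icc.1 (hf i)
  have hi2 := I.one_le_lb i
  have hi3 := I.ub_le i
  obtain ⟨w, hw⟩ : ∃ w, f i = w + 1 := ⟨f i - 1, by omega⟩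
  rw [hw, Nat.add_sub_cancel] at h
  set m := valuesIn f ((I.S ∩ I.T).erase i) with hm
  have hadd : ∀ p r q, m p q ≤ m p r + m r q := valuesIn_le_add f _
  have hdist : ∀ p q, m p q ≤ I.dist p q := fun p q =>
    (valuesIn_erase_le f _ i p q).trans (valuesIn_le_dist hf hS hT p q)
  have hslack : ∀ Q, Q = I.S \ I.T ∨ Q = I.T \ I.S → ∀ p q, p ≤ w → w < q →
      m p q + 1 ≤ I.slack Q p q := by
    rintro Q (rfl | rfl) p q hp hq
    · rw [hm, valuesIn_erase_add_one hi (by omega) (by omega)]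
      exact valuesIn_le_slack_left hf hS p q
    · rw [hm, valuesIn_erase_add_one hi (by omega) (by omega)]
      exact valuesIn_le_slack_right hf hT p q
  have hreach : ∀ Q, Q = I.S \ I.T ∨ Q = I.T \ I.S → ∀ k y, w < y →
      m k y + 1 ≤ I.reach Q w k y := by
    intro Q hQ k y hy
    have key : ∀ p ≤ w, m k y + 1 ≤ I.dist k p + I.slack Q p y := fun p hp => by
      have h1 := hadd k p y
      have h2 := hdist k p
      have h3 := hslack Q hQ p y hp hy
      omega
    exact le_runMin (key 0 (by omega)) fun p hp => key p (by omega)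
  have hpast : ∀ Q, Q = I.S \ I.T ∨ Q = I.T \ I.S → ∀ k, m k (w + 1) + 1 ≤ I.reachPast Q w k := by
    intro Q hQ k
    have key : ∀ y, w < y → m k (w + 1) + 1 ≤ I.reach Q w k y := fun y hy =>
      (Nat.add_le_add_right (valuesIn_mono_right f _ k hy) 1).trans (hreach Q hQ k y hy)
    exact le_runMin (key d (by omega)) fun y _ => key _ (by omega)
  have htwice : ∀ y, w < y → m l y + 2 ≤ I.reachTwice w l y := by
    intro y hy
    have a1 := hreach _ (Or.inl rfl) l y hy
    have a2 := hreach _ (Or.inr rfl) l y hy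
    have a3 := hreach _ (Or.inl rfl) d y hy
    have a4 := hreach _ (Or.inr rfl) d y hy
    have b1 := hpast _ (Or.inl rfl) l
    have b2 := hpast _ (Or.inr rfl) l
    have b3 := hpast _ (Or.inl rfl) d
    have b4 := hpast _ (Or.inr rfl) d
    have c1 := hadd l (w + 1) y
    -- When different intervals start first and end last, the last one is charged only for the
    -- values beyond `w + 1`; those up to `w + 1` are charged to the first by `hpast`.
    have key : ∀ Q, Q = I.S \ I.T ∨ Q = I.T \ I.S → m (w + 1) y + 1 ≤ I.reach Q w d y := by
      intro Q hQ
      have key' : ∀ p ≤ w, m (w + 1) y + 1 ≤ I.dist d p + I.slack Q p y := fun p hp => by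
        have h3 := hslack Q hQ p y hp hy
        have h4 : m (w + 1) y ≤ m p y := by
          refine Finset.card_le_card fun i => ?_
          simp only [Finset.mem_filter]
          exact fun h' => ⟨h'.1, by omega, h'.2.2⟩
        omega
      exact le_runMin (key' 0 (by omega)) fun p hp => key' p (by omega)
    have k1 := key _ (Or.inl rfl)
    have k2 := key _ (Or.inr rfl)
    unfold reachTwice
    omega
  have hcover : m l u + 2 ≤ I.coverCost w l u := by
    have key : ∀ y, w < y → m l u + 2 ≤ I.reachTwice w l y + I.dist y u := fun y hy => by
      have h1 := htwice y hy
      have h2 := hadd l y u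
      have h3 := hdist y u
      omega
    exact le_runMin (key d (by omega)) fun j _ => key _ (by omega)
  have hcount : _ ≤ m l u := count_le_valuesIn hf ((I.S ∩ I.T).erase i) l u
  have hcount' : I.count (I.S ∩ I.T) l u ≤ I.count ((I.S ∩ I.T).erase i) l u +
      (if l < I.lb i ∧ I.ub i ≤ u then 1 else 0) := by
    unfold count
    rw [Finset.filter_erase]
    split_ifs with h'
    · rw [Finset.card_erase_add_one (Finset.mem_filter.2 ⟨hi, h'⟩)]
    · rw [Finset.erase_eq_of_notMem (s := (I.S ∩ I.T).filter fun i => l < I.lb i ∧ I.ub i ≤ u)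
        fun h2 => h' (Finset.mem_filter.1 h2).2]
      omega
  omega

-- If `Consistent` fails there is no solution, so emptying the domains of `S ∩ T` is sound.
variable (I) in
theorem enforcesRuleThree_of_mem_iff {D' : Fin n → Finset ℕ}
    (hD : ∀ i v, v ∈ D' i ↔ v ∈ I.dom i ∧ (i ∈ I.S ∩ I.T → I.Consistent ∧ ¬ I.Excluded (v - 1) i)) :
    EnforcesRuleThree I.dom I.S I.T D' where
  subset i v hv := ((hD i v).1 hv).1
  eq_of_notMem i hi := by
    ext v
    rw [hD]
    tauto
  sound M hM e he := by
    obtain ⟨f, hf, hS, hT, hM'⟩ := I.exists_solution_of_isSimMatching hM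
    rw [hM' e he, hD]
    exact ⟨hf _, fun hi => ⟨consistent_of_solution hf hS hT, not_excluded_of_solution hf hS hT hi⟩⟩
  rule P hP i hi v hv hvD := by
    have h := (hD i v).1 hvD
    obtain ⟨hc, hex⟩ := h.2 (Finset.mem_sdiff.1 hi).1
    have h1 := Finset.mem_Icc.1 h.1
    have h2 := I.one_le_lb i
    exact hex (I.excluded_of_isAlmostSimHallSet hc hP hi (by rwa [Nat.sub_add_cancel (by omega)]))

end OverlappingAllDiff

/-! ## Loop programs -/

/-- The numbers of iterations that the loops of a loop program may have. -/
inductive LoopBound where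
  | n
  | d
  | dSucc
  | nAddD

namespace LoopBound

/-- The number of iterations. -/
def val (n d : ℕ) : LoopBound → ℕ
  | .n => n
  | .d => d
  | .dSucc => d + 1
  | .nAddD => n + d

/-- The number of iterations as an expression. -/
def expr : LoopBound → RExpr
  | .n => .cell 0 (.const 0)
  | .d => .cell 0 (.const 1)
  | .dSucc => .add (.cell 0 (.const 1)) (.const 1)
  | .nAddD => .add (.cell 0 (.const 0)) (.cell 0 (.const 1))

/-- The degree of the number of iterations in `n`. -/
def degN : LoopBound → ℕ
  | .n => 1
  | .d => 0
  | .dSucc => 0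
  | .nAddD => 1

/-- The degree of the number of iterations in `d`. -/
def degD : LoopBound → ℕ
  | .n => 0
  | .d => 1
  | .dSucc => 1
  | .nAddD => 1

theorem eval_expr {n d : ℕ} {σ : Memory} (hn : σ 0 0 = n) (hd : σ 0 1 = d) (b : LoopBound) :
    b.expr.eval σ = b.val n d := by
  cases b <;> simp [expr, val, RExpr.eval, hn, hd]

theorem cost_expr_le (b : LoopBound) : b.expr.cost ≤ 5 := by
  cases b <;> simp [expr, RExpr.cost]

theorem val_le {n d : ℕ} (hn : 1 ≤ n) (hd : 1 ≤ d) (b : LoopBound) :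
    b.val n d ≤ 2 * (n ^ b.degN * d ^ b.degD) := by
  cases b <;> simp only [val, degN, degD, pow_zero, pow_one] <;> nlinarith

theorem one_le_val {n d : ℕ} (hn : 1 ≤ n) (hd : 1 ≤ d) (b : LoopBound) : 1 ≤ b.val n d := by
  cases b <;> simp only [val] <;> omega

end LoopBound

/-- Programs built from assignments by composition and by loops whose bounds are known in advance;
the counter of a loop is cell 0 of the array `r`. -/
inductive LoopProg where
  | set (k : ℕ) (e₁ e₂ : RExpr)
  | seq (p q : LoopProg)
  | loop (r : ℕ) (b : LoopBound) (p : LoopProg)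

/-- Writes `v` into cell 0 of the array `r`. -/
def setReg (r v : ℕ) (σ : Memory) : Memory :=
  Function.update σ r (Function.update (σ r) 0 v)

/-- The memory after `j` rounds of a loop with counter `r` and body `f`. -/
def loopState (r : ℕ) (f : Memory → Memory) (σ : Memory) : ℕ → Memory
  | 0 => setReg r 0 σ
  | j + 1 => setReg r (j + 1) (f (loopState r f σ j))

namespace LoopProg

/-- The program for the random access machine. -/
def toProg : LoopProg → RProg
  | set k e₁ e₂ => .store k e₁ e₂
  | seq p q => .seq p.toProg q.toProg
  | loop r b p => .seq (.store r (.const 0) (.const 0))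
      (.loop (.sub b.expr (.cell r (.const 0)))
        (.seq p.toProg (.store r (.const 0) (.add (.cell r (.const 0)) (.const 1)))))

/-- The final memory. -/
def exec (n d : ℕ) : LoopProg → Memory → Memory
  | set k e₁ e₂, σ => Function.update σ k (Function.update (σ k) (e₁.eval σ) (e₂.eval σ))
  | seq p q, σ => q.exec n d (p.exec n d σ)
  | loop r b p, σ => loopState r (p.exec n d) σ (b.val n d)

/-- The arrays that a program writes to. -/
def writes : LoopProg → List ℕ
  | set k _ _ => [k]
  | seq p q => p.writes ++ q.writes
  | loop r _ p => r :: p.writes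

/-- No program writes to array 0, and no loop body writes to the counter of the loop. -/
def WellFormed : LoopProg → Prop
  | set k _ _ => k ≠ 0
  | seq p q => p.WellFormed ∧ q.WellFormed
  | loop r _ p => r ≠ 0 ∧ r ∉ p.writes ∧ p.WellFormed

/-- The coefficient of the time bound. -/
def coeff : LoopProg → ℕ
  | set _ e₁ e₂ => e₁.cost + e₂.cost + 1
  | seq p q => p.coeff + q.coeff
  | loop _ _ p => 2 * (p.coeff + 27)

/-- The degree of the time bound in `n`. -/
def degN : LoopProg → ℕ
  | set _ _ _ => 0
  | seq p q => max p.degN q.degN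
  | loop _ b p => b.degN + p.degN

/-- The degree of the time bound in `d`. -/
def degD : LoopProg → ℕ
  | set _ _ _ => 0
  | seq p q => max p.degD q.degD
  | loop _ b p => b.degD + p.degD

variable {n d : ℕ}

theorem exec_of_notMem_writes (p : LoopProg) (σ : Memory) {k : ℕ} (hk : k ∉ p.writes) :
    p.exec n d σ k = σ k := by
  induction p generalizing σ with
  | set j e₁ e₂ =>
    simp only [writes, List.mem_singleton] at hk
    simp [exec, Function.update_of_ne hk]
  | seq p q ihp ihq =>
    simp only [writes, List.mem_append, not_or] at hk
    rw [exec, ihq _ hk.2, ihp _ hk.1]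
  | loop r b p ih =>
    simp only [writes, List.mem_cons, not_or] at hk
    rw [exec]
    induction b.val n d with
    | zero => simp [loopState, setReg, Function.update_of_ne hk.1]
    | succ j ihj => simp [loopState, setReg, Function.update_of_ne hk.1, ih _ hk.2, ihj]

theorem notMem_writes_zero {p : LoopProg} (hp : p.WellFormed) : 0 ∉ p.writes := by
  induction p with
  | set j e₁ e₂ => simpa [writes] using Ne.symm hp
  | seq p q ihp ihq => simp [writes, ihp hp.1, ihq hp.2]
  | loop r b p ih => simp [writes, ih hp.2.2, Ne.symm hp.1]

theorem loopState_of_notMem (p : LoopProg) (r : ℕ) (σ : Memory) (j : ℕ) {k : ℕ} (hr : k ≠ r)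
    (hk : k ∉ p.writes) : loopState r (p.exec n d) σ j k = σ k := by
  induction j with
  | zero => simp [loopState, setReg, Function.update_of_ne hr]
  | succ j ih => simp [loopState, setReg, Function.update_of_ne hr, exec_of_notMem_writes _ _ hk, ih]

theorem loopState_reg (p : LoopProg) (r : ℕ) (σ : Memory) (j : ℕ) :
    loopState r (p.exec n d) σ j r 0 = j := by
  cases j <;> simp [loopState, setReg]

/-- The running time of a loop program is bounded by its degree. -/
theorem exists_runs_exec (hn : 1 ≤ n) (hd : 1 ≤ d) (p : LoopProg) (hp : p.WellFormed) (σ : Memory)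
    (h0 : σ 0 0 = n) (h1 : σ 0 1 = d) :
    ∃ t, t ≤ p.coeff * (n ^ p.degN * d ^ p.degD) ∧ Runs p.toProg σ t (p.exec n d σ) := by
  induction p generalizing σ with
  | set k e₁ e₂ => exact ⟨_, by simp [coeff, degN, degD], Runs.store k e₁ e₂ σ⟩
  | seq p q ihp ihq =>
    obtain ⟨t, ht, hr⟩ := ihp hp.1 σ h0 h1
    have h2 := exec_of_notMem_writes (n := n) (d := d) p σ (notMem_writes_zero hp.1)
    obtain ⟨t', ht', hr'⟩ := ihq hp.2 (p.exec n d σ) (by rw [h2, h0]) (by rw [h2, h1])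
    refine ⟨t + t', ?_, Runs.seq hr hr'⟩
    simp only [coeff, degN, degD, add_mul]
    refine add_le_add (ht.trans ?_) (ht'.trans ?_) <;> gcongr <;>
      first | assumption | exact le_max_left _ _ | exact le_max_right _ _
  | loop r b p ih =>
    obtain ⟨hr0, hrp, hp'⟩ := hp
    set T := p.coeff * (n ^ p.degN * d ^ p.degD) with hT
    set N := b.val n d with hN
    have hmem : ∀ j, loopState r (p.exec n d) σ j 0 = σ 0 := fun j =>
      loopState_of_notMem p r σ j hr0.symm (notMem_writes_zero hp')
    have hexpr : ∀ j, (RExpr.sub b.expr (.cell r (.const 0))).eval (loopState r (p.exec n d) σ j) =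
        N - j := fun j => by
      rw [RExpr.eval, b.eval_expr (by rw [hmem, h0]) (by rw [hmem, h1])]
      simp only [RExpr.eval, loopState_reg, hN]
    have hcost : (RExpr.sub b.expr (.cell r (.const 0))).cost ≤ 8 := by
      have := b.cost_expr_le
      simp only [RExpr.cost]
      omega
    -- Besides its body, a round costs at most 9 for the test and 6 for the counter; the final
    -- failing test costs at most 9.
    have key : ∀ m j, j + m = N → ∃ t, t ≤ m * (T + 15) + 9 ∧
        Runs (.loop (.sub b.expr (.cell r (.const 0)))
          (.seq p.toProg (.store r (.const 0) (.add (.cell r (.const 0)) (.const 1)))))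
          (loopState r (p.exec n d) σ j) t (loopState r (p.exec n d) σ N) := by
      intro m
      induction m with
      | zero =>
        rintro j rfl
        exact ⟨_, by omega, Runs.loop_done (by rw [hexpr]; omega)⟩
      | succ m ihm =>
        intro j hj
        obtain ⟨t, ht, hrun⟩ := ih hp' (loopState r (p.exec n d) σ j) (by rw [hmem, h0])
          (by rw [hmem, h1])
        obtain ⟨t', ht', hrun'⟩ := ihm (j + 1) (by omega)
        have hstore := Runs.store r (.const 0) (.add (.cell r (.const 0)) (.const 1))
          (p.exec n d (loopState r (p.exec n d) σ j))
        have hreg : p.exec n d (loopState r (p.exec n d) σ j) r 0 = j := by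
          rw [exec_of_notMem_writes _ _ hrp, loopState_reg]
        have hnext : Function.update (p.exec n d (loopState r (p.exec n d) σ j)) r
            (Function.update (p.exec n d (loopState r (p.exec n d) σ j) r)
              ((RExpr.const 0).eval (p.exec n d (loopState r (p.exec n d) σ j)))
              ((RExpr.add (.cell r (.const 0)) (.const 1)).eval
                (p.exec n d (loopState r (p.exec n d) σ j)))) =
            loopState r (p.exec n d) σ (j + 1) := by
          simp only [RExpr.eval, hreg, loopState, setReg]
        rw [hnext] at hstore
        refine ⟨_, ?_, Runs.loop_step (by rw [hexpr]; omega) (Runs.seq hrun hstore) hrun'⟩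
        simp only [RExpr.cost] at hcost ⊢
        rw [Nat.succ_mul]
        omega
    obtain ⟨t, ht, hrun⟩ := key N 0 (by omega)
    refine ⟨_, ?_, Runs.seq (Runs.store r (.const 0) (.const 0) σ) hrun⟩
    simp only [coeff, degN, degD, RExpr.cost]
    have h2 := b.val_le hn hd
    have h3 := b.one_le_val hn hd
    have h4 : 1 ≤ n ^ p.degN * d ^ p.degD := Nat.one_le_iff_ne_zero.2 (by positivity)
    have h5 : T + 27 ≤ (p.coeff + 27) * (n ^ p.degN * d ^ p.degD) := by
      rw [add_mul]
      omega
    have h6 : N * (T + 27) ≤ 2 * (n ^ b.degN * d ^ b.degD) *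
        ((p.coeff + 27) * (n ^ p.degN * d ^ p.degD)) := Nat.mul_le_mul h2 h5
    have h7 : 2 * (n ^ b.degN * d ^ b.degD) * ((p.coeff + 27) * (n ^ p.degN * d ^ p.degD)) =
        2 * (p.coeff + 27) * (n ^ (b.degN + p.degN) * d ^ (b.degD + p.degD)) := by
      rw [pow_add, pow_add]
      ring
    rw [← h7]
    refine le_trans ?_ h6
    -- Initialization (3) and the final test (9) cost 12, absorbed by 12 extra steps per round
    -- because `N ≥ 1`.
    have h8 : N * (T + 27) = N * (T + 15) + 12 * N := by ring
    omega

/-- Reasoning with a loop invariant. -/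
theorem exec_loop_induction {r : ℕ} {b : LoopBound} {p : LoopProg} {σ : Memory}
    (Inv : ℕ → Memory → Prop) (h0 : Inv 0 (setReg r 0 σ))
    (hs : ∀ j < b.val n d, ∀ τ : Memory, τ r 0 = j → (∀ k, k ≠ r → k ∉ p.writes → τ k = σ k) →
      Inv j τ → Inv (j + 1) (setReg r (j + 1) (p.exec n d τ))) :
    Inv (b.val n d) ((loop r b p).exec n d σ) := by
  have key : ∀ j ≤ b.val n d, Inv j (loopState r (p.exec n d) σ j) := by
    intro j
    induction j with
    | zero => exact fun _ => h0
    | succ j ih =>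
      intro hj
      exact hs j (by omega) _ (loopState_reg p r σ j)
        (fun k h1 h2 => loopState_of_notMem p r σ j h1 h2) (ih (by omega))
  exact key _ le_rfl

end LoopProg

@[simp] theorem setReg_of_ne {r k : ℕ} (h : k ≠ r) (v : ℕ) (σ : Memory) : setReg r v σ k = σ k := by
  simp [setReg, h]

@[simp] theorem setReg_self (r v : ℕ) (σ : Memory) : setReg r v σ r 0 = v := by
  simp [setReg]

/-- Row-major indices determine the row and the column. -/
theorem rowMajor_inj {d x y x' y' : ℕ} (hy : y ≤ d) (hy' : y' ≤ d)
    (h : x * (d + 1) + y = x' * (d + 1) + y') : x = x' ∧ y = y' := by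
  have h1 : (y + (d + 1) * x) / (d + 1) = (y' + (d + 1) * x') / (d + 1) := by
    congr 1
    linarith
  rw [Nat.add_mul_div_left _ _ (by omega), Nat.add_mul_div_left _ _ (by omega),
    Nat.div_eq_of_lt (by omega), Nat.div_eq_of_lt (by omega)] at h1
  have h2 : x = x' := by omega
  subst h2
  exact ⟨rfl, by omega⟩

/-! ### Tables in row-major order and the loops that fill them. -/

namespace LoopProg

variable {n d : ℕ}

/-- Cell 0 of the array `k`. -/
abbrev reg (k : ℕ) : RExpr := .cell k (.const 0)

/-- The entry in row `x` and column `y` of the table `k`; array 6 holds the row offsets. -/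
abbrev entry (k : ℕ) (x y : RExpr) : RExpr := .cell k (.add (.cell 6 x) y)

/-- The minimum of two expressions. -/
def minExpr (a b : RExpr) : RExpr := .sub a (.sub a b)

theorem eval_minExpr (σ : Memory) (a b : RExpr) :
    (minExpr a b).eval σ = min (a.eval σ) (b.eval σ) := by
  simp only [minExpr, RExpr.eval]
  omega

/-- The maximum of two expressions. -/
def maxExpr (a b : RExpr) : RExpr := .add a (.sub b a)

theorem eval_maxExpr (σ : Memory) (a b : RExpr) :
    (maxExpr a b).eval σ = max (a.eval σ) (b.eval σ) := by
  simp only [maxExpr, RExpr.eval]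
  omega

/-- Assigns `e` to all entries of the table `k`; the counters are 21 for the rows and 22 for the
columns. -/
def fill (k : ℕ) (e : RExpr) : LoopProg :=
  .loop 21 .dSucc (.loop 22 .dSucc (.set k (.add (.cell 6 (reg 21)) (reg 22)) e))

/-- Assigns `e` to the cells `0, …, d` of the array `k`; the counter is 21. -/
def fillRow (k : ℕ) (e : RExpr) : LoopProg :=
  .loop 21 .dSucc (.set k (reg 21) e)

/-- Adds to cell 0 of the array `k` the values of `e` over all rows 21 and columns 22. -/
def accumulate (k : ℕ) (e : RExpr) : LoopProg :=
  .loop 21 .dSucc (.loop 22 .dSucc (.set k (.const 0) (.add (reg k) e)))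

@[simp] theorem writes_fill (k : ℕ) (e : RExpr) : (fill k e).writes = [21, 22, k] := rfl

@[simp] theorem writes_fillRow (k : ℕ) (e : RExpr) : (fillRow k e).writes = [21, k] := rfl

@[simp] theorem writes_accumulate (k : ℕ) (e : RExpr) : (accumulate k e).writes = [21, 22, k] := rfl

/-- In the table being filled, `e` is only guaranteed the old content of the entry about to be
written. This suffices for in-place updates of the form "new entry from old entry and other arrays".
-/
theorem exec_fill {k : ℕ} {e : RExpr} {σ : Memory} (F : ℕ → ℕ → ℕ)
    (hrow : ∀ x ≤ d, σ 6 x = x * (d + 1)) (h6 : k ≠ 6) (h21 : k ≠ 21) (h22 : k ≠ 22)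
    (he : ∀ x ≤ d, ∀ y ≤ d, ∀ τ : Memory, τ 21 0 = x → τ 22 0 = y →
      (∀ j, j ≠ k → j ≠ 21 → j ≠ 22 → τ j = σ j) →
      τ k (x * (d + 1) + y) = σ k (x * (d + 1) + y) → e.eval τ = F x y) :
    ∀ x ≤ d, ∀ y ≤ d, (fill k e).exec n d σ k (x * (d + 1) + y) = F x y := by
  have key := exec_loop_induction (n := n) (d := d) (r := 21) (b := .dSucc)
    (p := .loop 22 .dSucc (.set k (.add (.cell 6 (reg 21)) (reg 22)) e)) (σ := σ)
    (fun j τ => ∀ x ≤ d, ∀ y ≤ d, τ k (x * (d + 1) + y) =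
      if x < j then F x y else σ k (x * (d + 1) + y))
    (by intro x _ y _; simp [h21]) (by
      intro j hj τ hτ hfr ih x hx y hy
      have key := exec_loop_induction (n := n) (d := d) (r := 22) (b := .dSucc)
        (p := .set k (.add (.cell 6 (reg 21)) (reg 22)) e) (σ := τ)
        (fun j' τ' => ∀ x ≤ d, ∀ y ≤ d, τ' k (x * (d + 1) + y) =
          if x < j ∨ x = j ∧ y < j' then F x y else σ k (x * (d + 1) + y))
        (by intro x hx y hy; simp [h22, ih x hx y hy]) (by
          intro j' hj' τ' hτ' hfr' ih' x hx y hy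
          simp only [LoopBound.val] at hj hj'
          have e6 : τ' 6 j = j * (d + 1) := by
            rw [hfr' 6 (by decide) (by simpa [writes] using h6.symm),
              hfr 6 (by decide) (by simpa [writes] using h6.symm), hrow j (by omega)]
          have e21 : τ' 21 0 = j := by
            rw [hfr' 21 (by decide) (by simpa [writes] using h21.symm), hτ]
          have ev := he j (by omega) j' (by omega) τ' e21 hτ' (fun i h1 h2 h3 => by
            rw [hfr' i h3 (by simpa [writes] using h1), hfr i h2 (by simp [writes, h1, h3])])
            (by rw [ih' j (by omega) j' (by omega), if_neg (by omega)])
          rw [setReg_of_ne h22]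
          simp only [exec, RExpr.eval, e21, hτ', e6, ev, Function.update_self]
          by_cases hxy : x = j ∧ y = j'
          · obtain ⟨rfl, rfl⟩ := hxy
            rw [Function.update_self, if_pos (by omega)]
          · rw [Function.update_of_ne (fun h => hxy (rowMajor_inj hy (by omega) h)), ih' x hx y hy]
            have : (x < j ∨ x = j ∧ y < j') ↔ (x < j ∨ x = j ∧ y < j' + 1) := by omega
            simp only [this])
      rw [setReg_of_ne h21, key x hx y hy]
      simp only [LoopBound.val]
      have : (x < j ∨ x = j ∧ y < d + 1) ↔ x < j + 1 := by omega
      simp only [this])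
  intro x hx y hy
  have h := key x hx y hy
  rwa [if_pos (by simp only [LoopBound.val]; omega)] at h

theorem exec_fillRow {k : ℕ} {e : RExpr} {σ : Memory} (F : ℕ → ℕ) (h21 : k ≠ 21)
    (he : ∀ x ≤ d, ∀ τ : Memory, τ 21 0 = x → (∀ j, j ≠ k → j ≠ 21 → τ j = σ j) →
      τ k x = σ k x → e.eval τ = F x) :
    ∀ x ≤ d, (fillRow k e).exec n d σ k x = F x := by
  have key := exec_loop_induction (n := n) (d := d) (r := 21) (b := .dSucc)
    (p := .set k (reg 21) e) (σ := σ)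
    (fun j τ => ∀ x ≤ d, τ k x = if x < j then F x else σ k x)
    (by intro x _; simp [h21]) (by
      intro j hj τ hτ hfr ih x hx
      simp only [LoopBound.val] at hj
      have ev := he j (by omega) τ hτ (fun i h1 h2 => hfr i h2 (by simpa [writes] using h1))
        (by rw [ih j (by omega), if_neg (by omega)])
      rw [setReg_of_ne h21]
      simp only [exec, RExpr.eval, hτ, ev, Function.update_self]
      by_cases hxj : x = j
      · subst hxj
        rw [Function.update_self, if_pos (by omega)]
      · rw [Function.update_of_ne hxj, ih x hx]
        have : x < j ↔ x < j + 1 := by omega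
        simp only [this])
  intro x hx
  have h := key x hx
  rwa [if_pos (by simp only [LoopBound.val]; omega)] at h

theorem exec_accumulate {k : ℕ} {e : RExpr} {σ : Memory} (F : ℕ → ℕ → ℕ) (h21 : k ≠ 21)
    (h22 : k ≠ 22) (he : ∀ x ≤ d, ∀ y ≤ d, ∀ τ : Memory, τ 21 0 = x → τ 22 0 = y →
      (∀ j, j ≠ k → j ≠ 21 → j ≠ 22 → τ j = σ j) → e.eval τ = F x y) :
    (accumulate k e).exec n d σ k 0 =
      σ k 0 + ∑ x ∈ Finset.range (d + 1), ∑ y ∈ Finset.range (d + 1), F x y := by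
  refine exec_loop_induction (n := n) (d := d) (r := 21) (b := .dSucc)
    (p := .loop 22 .dSucc (.set k (.const 0) (.add (reg k) e))) (σ := σ)
    (fun j τ => τ k 0 = σ k 0 + ∑ x ∈ Finset.range j, ∑ y ∈ Finset.range (d + 1), F x y)
    (by simp [h21]) ?_
  intro j hj τ hτ hfr ih
  rw [setReg_of_ne h21, Finset.sum_range_succ, ← add_assoc, ← ih]
  refine exec_loop_induction (n := n) (d := d) (r := 22) (b := .dSucc)
    (p := .set k (.const 0) (.add (reg k) e)) (σ := τ)
    (fun j' τ' => τ' k 0 = τ k 0 + ∑ y ∈ Finset.range j', F j y) (by simp [h22]) ?_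
  intro j' hj' τ' hτ' hfr' ih'
  simp only [LoopBound.val] at hj hj'
  have ev := he j (by omega) j' (by omega) τ'
    (by rw [hfr' 21 (by decide) (by simpa [writes] using h21.symm), hτ]) hτ' (fun i h1 h2 h3 => by
      rw [hfr' i h3 (by simpa [writes] using h1), hfr i h2 (by simp [writes, h1, h3])])
  rw [setReg_of_ne h22, Finset.sum_range_succ, ← add_assoc, ← ih']
  simp [exec, RExpr.eval, ev]

end LoopProg

/-! ## The program -/

namespace LoopProg

/-- The current row. -/
abbrev rowReg : RExpr := reg 21

/-- The current column. -/
abbrev colReg : RExpr := reg 22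

/-- The current variable. -/
abbrev varReg : RExpr := reg 23

/-- The current value minus one. -/
abbrev valReg : RExpr := reg 24

/-- The number of values. -/
abbrev dExpr : RExpr := .cell 0 (.const 1)

/-- The successor of an expression. -/
abbrev succExpr (e : RExpr) : RExpr := .add e (.const 1)

/-- Zero if and only if the domain of the current variable is between the current row and column. -/
def outsideExpr : RExpr :=
  .add (.sub (succExpr rowReg) (.cell 1 varReg)) (.sub (.cell 2 varReg) colReg)

/-- Computes the row offsets of the tables. -/
def rowOffsets : LoopProg :=
  -- The machine has no multiplication, so multiples of `d + 1` are tabulated by addition. Rows are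
  -- indexed by nodes and, for the output, by variables; `n + d` exceeds neither range too little.
  .loop 21 .nAddD (.set 6 (succExpr rowReg) (.add (.cell 6 rowReg) (succExpr dExpr)))

/-- Counts the current variable in the table `k` unless `e` is nonzero. -/
def tally (k : ℕ) (e : RExpr) : LoopProg :=
  fill k (.add (entry k rowReg colReg) (.sub (.const 1) (.add outsideExpr e)))

/-- Counts in the tables 10, 11, 12 the variables of `S \ T`, `T \ S`, `S ∩ T` inside the intervals. -/
def computeCounts : LoopProg :=
  .loop 23 .n
    (.seq (tally 10 (.add (.sub (.const 1) (.cell 3 varReg)) (.cell 4 varReg)))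
      (.seq (tally 11 (.add (.sub (.const 1) (.cell 4 varReg)) (.cell 3 varReg)))
        (tally 12 (.add (.sub (.const 1) (.cell 3 varReg)) (.sub (.const 1) (.cell 4 varReg))))))

/-- Computes the slacks for `S \ T` and for `T \ S` in the tables 13 and 14. -/
def computeSlacks : LoopProg :=
  .seq (fill 13 (.sub (.sub colReg rowReg) (entry 10 rowReg colReg)))
    (fill 14 (.sub (.sub colReg rowReg) (entry 11 rowReg colReg)))

/-- Computes the distances in the table 15. -/
def computeDist : LoopProg :=
  .seq (fill 15 (minExpr (entry 13 rowReg colReg) (entry 14 rowReg colReg)))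
    (.loop 23 .dSucc
      -- A relaxation round reads other entries of the table, so it is computed in table 16 and
      -- copied back.
      (.seq (fill 16 (minExpr (entry 15 rowReg colReg)
          (.add (entry 15 rowReg varReg) (entry 15 varReg colReg))))
        (fill 15 (entry 16 rowReg colReg))))

/-- Makes cell 0 of the array 17 nonzero if some interval is overfull. -/
def computeFlag : LoopProg :=
  accumulate 17 (.add (.add (.sub (entry 10 rowReg colReg) (.sub colReg rowReg))
    (.sub (entry 11 rowReg colReg) (.sub colReg rowReg)))
    (.sub (entry 12 rowReg colReg) (entry 15 rowReg colReg)))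

/-- Initializes the costs of reaching in the table `k`, from the slacks in the table `s`. -/
def initReach (k s : ℕ) : LoopProg :=
  fill k (.add (entry 15 rowReg (.const 0)) (entry s (.const 0) colReg))

/-- Updates the costs of reaching in the table `k`, from the slacks in the table `s`. -/
def updateReach (k s : ℕ) : LoopProg :=
  fill k (minExpr (entry k rowReg colReg) (.add (entry 15 rowReg valReg) (entry s valReg colReg)))

/-- Computes in the array `k` the costs of passing the current value, from those of reaching in the
table `s`. -/
def computePast (k s : ℕ) : LoopProg :=
  .seq (fillRow k (entry s rowReg dExpr))
    (.loop 22 .dSucc (fillRow k (minExpr (.cell k rowReg)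
      (entry s rowReg (maxExpr colReg (succExpr valReg))))))

/-- Computes in the table 34 the costs of reaching with the current value covered twice. -/
def computeTwice : LoopProg :=
  fill 34 (minExpr
    (minExpr (.add (entry 30 rowReg colReg) (.cell 33 dExpr))
      (.add (entry 31 rowReg colReg) (.cell 32 dExpr)))
    (minExpr (.add (.cell 32 rowReg) (entry 31 dExpr colReg))
      (.add (.cell 33 rowReg) (entry 30 dExpr colReg))))

/-- Computes in the table 35 the costs of covering with the current value covered twice. -/
def computeCover : LoopProg :=
  .seq (fill 35 (.add (entry 34 rowReg dExpr) (entry 15 dExpr colReg)))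
    (.loop 23 .n (fill 35 (minExpr (entry 35 rowReg colReg)
      (.add (entry 34 rowReg (maxExpr (.cell 2 varReg) (succExpr valReg)))
        (entry 15 (maxExpr (.cell 2 varReg) (succExpr valReg)) colReg)))))

/-- Makes cell 0 of the array 36 nonzero if the current value is excluded for the current variable or
if some interval is overfull. -/
def testExcluded : LoopProg :=
  .seq (.set 36 (.const 0) (reg 17))
    -- With truncated subtraction, `1 - (A - B)` is one if `A ≤ B` and zero otherwise.
    (accumulate 36 (.sub (.const 1) (.sub (.add (entry 35 rowReg colReg)
      (.sub (.const 1) outsideExpr)) (.add (.const 1) (entry 12 rowReg colReg)))))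

/-- One if the current value is kept for the current variable, and zero otherwise. -/
def keepExpr : RExpr :=
  -- The inner `1 - (1 - _)` normalizes the test result to 0 or 1. Added to the two membership bits
  -- it exceeds 2 only if the variable is in `S ∩ T` and the test fired.
  .sub (.const 1) (.add
    (.add (.sub (.cell 1 varReg) (succExpr valReg)) (.sub (succExpr valReg) (.cell 2 varReg)))
    (.sub (.add (.add (.sub (.const 1) (.sub (.const 1) (reg 36))) (.cell 3 varReg))
      (.cell 4 varReg)) (.const 2)))

/-- Writes the column of the current value of the output. -/
def writeColumn : LoopProg :=
  .loop 23 .n (.seq testExcluded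
    (.set 5 (.add (.cell 6 varReg) (succExpr valReg)) keepExpr))

/-- Treats the current value. -/
def processValue : LoopProg :=
  .seq (updateReach 30 13) (.seq (updateReach 31 14) (.seq (computePast 32 30)
    (.seq (computePast 33 31) (.seq computeTwice (.seq computeCover writeColumn)))))

/-- The program for Rule 3. -/
def ruleThree : LoopProg :=
  .seq rowOffsets (.seq computeCounts (.seq computeSlacks (.seq computeDist (.seq computeFlag
    (.seq (initReach 30 13) (.seq (initReach 31 14) (.loop 24 .d processValue)))))))

theorem wellFormed_ruleThree : ruleThree.WellFormed := by
  simp [ruleThree, rowOffsets, computeCounts, tally, computeSlacks, computeDist, computeFlag,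
    initReach, updateReach, computePast, computeTwice, computeCover, testExcluded, writeColumn,
    processValue, WellFormed, writes, fill, fillRow, accumulate]

/-- The dominant parts are `computeCover` and `writeColumn`: `n` passes over a table, for each of
the `d` values. -/
theorem degN_ruleThree : ruleThree.degN = 1 := rfl

theorem degD_ruleThree : ruleThree.degD = 3 := rfl

end LoopProg

/-! ## Correctness of the program -/

namespace OverlappingAllDiff

open LoopProg

variable {n d : ℕ} (I : OverlappingAllDiff n d)

/-- The memory holds the instance and the row offsets of the tables. -/
structure Loaded (σ : Memory) : Prop where
  d_eq : σ 0 1 = d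
  lb_eq : ∀ i : Fin n, σ 1 i = I.lb i
  ub_eq : ∀ i : Fin n, σ 2 i = I.ub i
  S_eq : ∀ i : Fin n, σ 3 i = if i ∈ I.S then 1 else 0
  T_eq : ∀ i : Fin n, σ 4 i = if i ∈ I.T then 1 else 0
  row_eq : ∀ x ≤ n + d, σ 6 x = x * (d + 1)

variable {I}

theorem Loaded.congr {σ τ : Memory} (h : I.Loaded σ) (h0 : τ 0 = σ 0) (h1 : τ 1 = σ 1)
    (h2 : τ 2 = σ 2) (h3 : τ 3 = σ 3) (h4 : τ 4 = σ 4) (h6 : τ 6 = σ 6) : I.Loaded τ := by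
  obtain ⟨a, b, c, e, f, g⟩ := h
  exact ⟨h0 ▸ a, h1 ▸ b, h2 ▸ c, h3 ▸ e, h4 ▸ f, h6 ▸ g⟩

theorem Loaded.exec {σ : Memory} (h : I.Loaded σ) (p : LoopProg)
    (hp : ∀ k ∈ p.writes, k ≠ 0 ∧ k ≠ 1 ∧ k ≠ 2 ∧ k ≠ 3 ∧ k ≠ 4 ∧ k ≠ 6) :
    I.Loaded (p.exec n d σ) := by
  apply h.congr <;> refine exec_of_notMem_writes _ _ fun hk => ?_ <;> have := hp _ hk <;> omega

theorem Loaded.row {σ : Memory} (h : I.Loaded σ) : ∀ x ≤ d, σ 6 x = x * (d + 1) :=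
  fun x hx => h.row_eq x (by omega)

/-- The table `k` holds the function `F`. -/
def Holds (d : ℕ) (σ : Memory) (k : ℕ) (F : ℕ → ℕ → ℕ) : Prop :=
  ∀ x ≤ d, ∀ y ≤ d, σ k (x * (d + 1) + y) = F x y

theorem Holds.congr {σ τ : Memory} {k : ℕ} {F : ℕ → ℕ → ℕ} (h : Holds d σ k F) (hk : τ k = σ k) :
    Holds d τ k F := fun x hx y hy => by rw [hk, h x hx y hy]

theorem Holds.exec {σ : Memory} {k : ℕ} {F : ℕ → ℕ → ℕ} (h : Holds d σ k F) (p : LoopProg)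
    (hk : k ∉ p.writes) : Holds d (p.exec n d σ) k F :=
  h.congr (exec_of_notMem_writes p σ hk)

theorem loaded_exec_rowOffsets (I : OverlappingAllDiff n d) :
    I.Loaded (rowOffsets.exec n d I.initialMemory) := by
  have key : ∀ x ≤ n + d, rowOffsets.exec n d I.initialMemory 6 x = x * (d + 1) := by
    refine exec_loop_induction (n := n) (d := d) (r := 21) (b := .nAddD) (σ := I.initialMemory)
      (p := .set 6 (succExpr rowReg) (.add (.cell 6 rowReg) (succExpr dExpr)))
      (fun j τ => ∀ x ≤ j, τ 6 x = x * (d + 1)) ?_ ?_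
    · intro x hx
      obtain rfl : x = 0 := by omega
      simp [initialMemory]
    · intro j hj τ hτ hfr ih x hx
      have h0 : τ 0 1 = d := by
        rw [hfr 0 (by decide) (by simp [writes])]
        simp [initialMemory, arrayOf]
      rw [setReg_of_ne (by decide)]
      simp only [LoopProg.exec, RExpr.eval, hτ, Function.update_self, h0, ih j le_rfl]
      by_cases hxj : x = j + 1
      · subst hxj
        rw [Function.update_self]
        ring
      · rw [Function.update_of_ne hxj, ih x (by omega)]
  have hw : ∀ k, k ≠ 21 → k ≠ 6 → rowOffsets.exec n d I.initialMemory k = I.initialMemory k :=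
    fun k h1 h2 => exec_of_notMem_writes _ _ (by simp [rowOffsets, writes, h1, h2])
  refine ⟨?_, ?_, ?_, ?_, ?_, key⟩
  · rw [hw 0 (by decide) (by decide)]
    simp [initialMemory, arrayOf]
  all_goals
    intro i
    rw [hw _ (by decide) (by decide)]
    simp [initialMemory, arrayOf]

theorem count_eq_sum_range (Q : Finset (Fin n)) (x y : ℕ) :
    I.count Q x y = ∑ j ∈ Finset.range n,
      arrayOf (fun i => if i ∈ Q ∧ x < I.lb i ∧ I.ub i ≤ y then 1 else 0) j := by
  have h : Q.filter (fun i => x < I.lb i ∧ I.ub i ≤ y) =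
      Finset.univ.filter fun i => i ∈ Q ∧ x < I.lb i ∧ I.ub i ≤ y := by
    ext i
    simp
  rw [count, h, Finset.card_filter, Finset.sum_range]
  simp only [arrayOf, Fin.is_lt, dite_true, Fin.eta]

theorem indicator_and_not_eq_zero_iff (p q : Prop) [Decidable p] [Decidable q] :
    1 - (if p then 1 else 0) + (if q then 1 else 0) = 0 ↔ p ∧ ¬ q := by
  split_ifs <;> simp_all

theorem indicator_and_eq_zero_iff (p q : Prop) [Decidable p] [Decidable q] :
    1 - (if p then 1 else 0) + (1 - (if q then 1 else 0)) = 0 ↔ p ∧ q := by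
  split_ifs <;> simp_all

/-- One round of counting. -/
theorem exec_tally {σ : Memory} (hI : I.Loaded σ) (Q : Finset (Fin n)) {k : ℕ} {e : RExpr} (i : Fin n)
    (hi : σ 23 0 = i) (hk : 6 < k) (hk' : k < 21)
    (he : ∀ τ : Memory, τ 23 0 = i → τ 3 = σ 3 → τ 4 = σ 4 → (e.eval τ = 0 ↔ i ∈ Q)) {G : ℕ → ℕ → ℕ}
    (hG : Holds d σ k G) :
    Holds d ((tally k e).exec n d σ) k fun x y => G x y +
      arrayOf (fun i => if i ∈ Q ∧ x < I.lb i ∧ I.ub i ≤ y then 1 else 0) i := by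
  refine exec_fill _ hI.row (by omega) (by omega) (by omega) ?_
  intro x hx y hy τ h21 h22 hfr hown
  have h23 : τ 23 0 = i := by rw [hfr 23 (by omega) (by omega) (by omega), hi]
  have hQ := he τ h23 (hfr 3 (by omega) (by omega) (by omega)) (hfr 4 (by omega) (by omega) (by omega))
  simp only [outsideExpr, RExpr.eval, h21, h22, h23, hfr 6 (by omega) (by omega) (by omega),
    hfr 1 (by omega) (by omega) (by omega), hfr 2 (by omega) (by omega) (by omega),
    hI.lb_eq, hI.ub_eq, hI.row x hx, hown, hG x hx y hy]
  simp only [arrayOf, Fin.is_lt, dite_true, Fin.eta, ← hQ]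
  split_ifs <;> omega

theorem exec_computeCounts {σ : Memory} (hI : I.Loaded σ) (h10 : ∀ j, σ 10 j = 0)
    (h11 : ∀ j, σ 11 j = 0) (h12 : ∀ j, σ 12 j = 0) :
    Holds d (computeCounts.exec n d σ) 10 (I.count (I.S \ I.T)) ∧
    Holds d (computeCounts.exec n d σ) 11 (I.count (I.T \ I.S)) ∧
    Holds d (computeCounts.exec n d σ) 12 (I.count (I.S ∩ I.T)) := by
  set part : Finset (Fin n) → ℕ → ℕ → ℕ → ℕ := fun Q j x y => ∑ j ∈ Finset.range j,
    arrayOf (fun i => if i ∈ Q ∧ x < I.lb i ∧ I.ub i ≤ y then 1 else 0) j with hpart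
  have hfull : ∀ Q, I.count Q = part Q n := fun Q => by
    funext x y
    exact count_eq_sum_range Q x y
  rw [hfull, hfull, hfull]
  refine exec_loop_induction (n := n) (d := d) (r := 23) (b := .n) (σ := σ)
    (fun j τ => Holds d τ 10 (part (I.S \ I.T) j) ∧ Holds d τ 11 (part (I.T \ I.S) j) ∧
      Holds d τ 12 (part (I.S ∩ I.T) j)) ?_ ?_
  · refine ⟨?_, ?_, ?_⟩ <;> intro x _ y _ <;> simp [hpart, h10, h11, h12]
  · rintro j hj τ hτ hfr ⟨i1, i2, i3⟩
    have hsucc : ∀ Q, part Q (j + 1) = fun x y => part Q j x y +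
        arrayOf (fun i => if i ∈ Q ∧ x < I.lb i ∧ I.ub i ≤ y then 1 else 0) j := fun Q => by
      funext x y
      exact Finset.sum_range_succ _ _
    have hw : ∀ k, k ≠ 21 → k ≠ 22 → k ≠ 23 → k ≠ 10 → k ≠ 11 → k ≠ 12 → τ k = σ k :=
      fun k h1 h2 h3 h4 h5 h6 => hfr k h3 (by simp [writes, tally, h1, h2, h4, h5, h6])
    have hI' : I.Loaded τ := hI.congr (hw _ (by decide) (by decide) (by decide) (by decide) (by decide)
      (by decide)) (hw _ (by decide) (by decide) (by decide) (by decide) (by decide) (by decide))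
      (hw _ (by decide) (by decide) (by decide) (by decide) (by decide) (by decide))
      (hw _ (by decide) (by decide) (by decide) (by decide) (by decide) (by decide))
      (hw _ (by decide) (by decide) (by decide) (by decide) (by decide) (by decide))
      (hw _ (by decide) (by decide) (by decide) (by decide) (by decide) (by decide))
    have t1 := fun (ρ : Memory) (h : I.Loaded ρ) (h23 : ρ 23 0 = j) (k : ℕ) (e : RExpr) =>
      exec_tally (n := n) h (k := k) (e := e) (i := ⟨j, hj⟩) (hi := h23)
    simp only [LoopProg.exec]
    set e1 : RExpr := .add (.sub (.const 1) (.cell 3 varReg)) (.cell 4 varReg)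
    set e2 : RExpr := .add (.sub (.const 1) (.cell 4 varReg)) (.cell 3 varReg)
    set e3 : RExpr := .add (.sub (.const 1) (.cell 3 varReg)) (.sub (.const 1) (.cell 4 varReg))
    set τ1 := (tally 10 e1).exec n d τ with hτ1
    have hI1 : I.Loaded τ1 := hI'.exec _ (by simp [tally])
    set τ2 := (tally 11 e2).exec n d τ1 with hτ2
    have hI2 : I.Loaded τ2 := hI1.exec _ (by simp [tally])
    have r1 : τ1 23 0 = j := by rw [hτ1, exec_of_notMem_writes _ _ (by simp [tally]), hτ]
    have r2 : τ2 23 0 = j := by rw [hτ2, exec_of_notMem_writes _ _ (by simp [tally]), r1]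
    refine ⟨?_, ?_, ?_⟩
    · rw [hsucc]
      refine Holds.congr ?_ (setReg_of_ne (by decide) _ _)
      refine Holds.exec ?_ _ (by simp [tally])
      refine Holds.exec ?_ _ (by simp [tally])
      refine t1 τ hI' hτ 10 e1 (I.S \ I.T) (by decide) (by decide) ?_ i1
      intro ρ h23 h3 h4
      have g1 := hI'.S_eq ⟨j, hj⟩
      have g2 := hI'.T_eq ⟨j, hj⟩
      dsimp only at g1 g2 h23
      simp only [e1, RExpr.eval, h23, h3, h4, g1, g2, Finset.mem_sdiff,
        indicator_and_not_eq_zero_iff]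
    · rw [hsucc]
      refine Holds.congr ?_ (setReg_of_ne (by decide) _ _)
      refine Holds.exec ?_ _ (by simp [tally])
      refine t1 τ1 hI1 r1 11 e2 (I.T \ I.S) (by decide) (by decide) ?_
        (i2.exec _ (by simp [tally]))
      intro ρ h23 h3 h4
      have g1 := hI1.S_eq ⟨j, hj⟩
      have g2 := hI1.T_eq ⟨j, hj⟩
      dsimp only at g1 g2 h23
      simp only [e2, RExpr.eval, h23, h3, h4, g1, g2, Finset.mem_sdiff,
        indicator_and_not_eq_zero_iff]
    · rw [hsucc]
      refine Holds.congr ?_ (setReg_of_ne (by decide) _ _)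
      refine t1 τ2 hI2 r2 12 e3 (I.S ∩ I.T) (by decide) (by decide) ?_
        ((i3.exec _ (by simp [tally])).exec _ (by simp [tally]))
      intro ρ h23 h3 h4
      have g1 := hI2.S_eq ⟨j, hj⟩
      have g2 := hI2.T_eq ⟨j, hj⟩
      dsimp only at g1 g2 h23
      simp only [e3, RExpr.eval, h23, h3, h4, g1, g2, Finset.mem_inter,
        indicator_and_eq_zero_iff]

theorem exec_computeSlacks {σ : Memory} (hI : I.Loaded σ)
    (h10 : Holds d σ 10 (I.count (I.S \ I.T))) (h11 : Holds d σ 11 (I.count (I.T \ I.S))) :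
    Holds d (computeSlacks.exec n d σ) 13 (I.slack (I.S \ I.T)) ∧
    Holds d (computeSlacks.exec n d σ) 14 (I.slack (I.T \ I.S)) := by
  simp only [computeSlacks, LoopProg.exec]
  constructor
  · refine Holds.exec ?_ _ (by simp)
    refine exec_fill _ hI.row (by decide) (by decide) (by decide) ?_
    intro x hx y hy τ h21 h22 hfr _
    simp only [RExpr.eval, h21, h22, hfr 6 (by decide) (by decide) (by decide),
      hfr 10 (by decide) (by decide) (by decide), hI.row x hx, h10 x hx y hy, slack]
  · have hI' := hI.exec (fill 13 (.sub (.sub colReg rowReg) (entry 10 rowReg colReg))) (by simp)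
    have h11' := h11.exec (n := n) (fill 13 (.sub (.sub colReg rowReg) (entry 10 rowReg colReg)))
      (by simp)
    refine exec_fill _ hI'.row (by decide) (by decide) (by decide) ?_
    intro x hx y hy τ h21 h22 hfr _
    simp only [RExpr.eval, h21, h22, hfr 6 (by decide) (by decide) (by decide),
      hfr 11 (by decide) (by decide) (by decide), hI'.row x hx, h11' x hx y hy, slack]

theorem exec_computeDist {σ : Memory} (hI : I.Loaded σ) (h13 : Holds d σ 13 (I.slack (I.S \ I.T)))
    (h14 : Holds d σ 14 (I.slack (I.T \ I.S))) :
    Holds d (computeDist.exec n d σ) 15 I.dist := by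
  rw [computeDist, LoopProg.exec]
  set e₀ := minExpr (entry 13 rowReg colReg) (entry 14 rowReg colReg) with he₀
  set f : ℕ → ℕ → ℕ := fun p q => min (I.slack (I.S \ I.T) p q) (I.slack (I.T \ I.S) p q) with hf
  have hI0 := hI.exec (fill 15 e₀) (by simp)
  have h0 : Holds d ((fill 15 e₀).exec n d σ) 15 f := by
    refine exec_fill _ hI.row (by decide) (by decide) (by decide) ?_
    intro x hx y hy τ h21 h22 hfr _
    simp only [he₀, eval_minExpr, RExpr.eval, h21, h22, hfr 6 (by decide) (by decide) (by decide),
      hfr 13 (by decide) (by decide) (by decide), hfr 14 (by decide) (by decide) (by decide),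
      hI.row x hx, h13 x hx y hy, h14 x hx y hy, hf]
  set σ₀ := (fill 15 e₀).exec n d σ
  refine exec_loop_induction (n := n) (d := d) (r := 23) (b := .dSucc) (σ := σ₀)
    (fun j τ => Holds d τ 15 (relax f j)) ?_ ?_
  · exact h0.congr (setReg_of_ne (by decide) _ _)
  · intro j hj τ hτ hfr ih
    replace hj : j ≤ d := Nat.lt_succ_iff.1 hj
    refine Holds.congr ?_ (setReg_of_ne (by decide) _ _)
    simp only [LoopProg.exec]
    set e := minExpr (entry 15 rowReg colReg)
      (.add (entry 15 rowReg varReg) (entry 15 varReg colReg)) with he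
    have hrow : ∀ x ≤ d, τ 6 x = x * (d + 1) := fun x hx => by
      rw [hfr 6 (by decide) (by simp [writes]), hI0.row x hx]
    have h16 : Holds d ((fill 16 e).exec n d τ) 16 (relax f (j + 1)) := by
      refine exec_fill _ hrow (by decide) (by decide) (by decide) ?_
      intro x hx y hy ρ h21 h22 hfr' _
      have h23 : ρ 23 0 = j := by rw [hfr' 23 (by decide) (by decide) (by decide), hτ]
      simp only [he, eval_minExpr, RExpr.eval, h21, h22, h23,
        hfr' 6 (by decide) (by decide) (by decide), hfr' 15 (by decide) (by decide) (by decide),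
        hrow x hx, hrow j hj, ih x hx y hy, ih x hx j hj, ih j hj y hy, relax]
    have hrow' : ∀ x ≤ d, (fill 16 e).exec n d τ 6 x = x * (d + 1) := fun x hx => by
      rw [exec_of_notMem_writes _ _ (by simp), hrow x hx]
    refine exec_fill _ hrow' (by decide) (by decide) (by decide) ?_
    intro x hx y hy ρ h21 h22 hfr' _
    simp only [RExpr.eval, h21, h22, hfr' 6 (by decide) (by decide) (by decide),
      hfr' 16 (by decide) (by decide) (by decide), hrow' x hx, h16 x hx y hy]

/-- The summands are truncated excesses, so the total vanishes exactly when no interval is overfull.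
-/
theorem exec_computeFlag {σ : Memory} (hI : I.Loaded σ) (h17 : σ 17 0 = 0)
    (h10 : Holds d σ 10 (I.count (I.S \ I.T))) (h11 : Holds d σ 11 (I.count (I.T \ I.S)))
    (h12 : Holds d σ 12 (I.count (I.S ∩ I.T))) (h15 : Holds d σ 15 I.dist) :
    computeFlag.exec n d σ 17 0 = 0 ↔ I.Consistent := by
  rw [computeFlag, exec_accumulate (fun x y => (I.count (I.S \ I.T) x y - (y - x)) +
    (I.count (I.T \ I.S) x y - (y - x)) + (I.count (I.S ∩ I.T) x y - I.dist x y))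
    (by decide) (by decide), h17, zero_add]
  · simp only [Finset.sum_eq_zero_iff, Finset.mem_range, Nat.lt_succ_iff, Consistent]
    refine forall₄_congr fun x _ y _ => ?_
    omega
  · intro x hx y hy τ h21 h22 hfr
    simp only [RExpr.eval, h21, h22, hfr 6 (by decide) (by decide) (by decide),
      hfr 10 (by decide) (by decide) (by decide), hfr 11 (by decide) (by decide) (by decide),
      hfr 12 (by decide) (by decide) (by decide), hfr 15 (by decide) (by decide) (by decide),
      hI.row x hx, h10 x hx y hy, h11 x hx y hy, h12 x hx y hy, h15 x hx y hy]

end OverlappingAllDiff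

/-! ### The loop over the values. -/

namespace OverlappingAllDiff

open LoopProg

variable {n d : ℕ} (I : OverlappingAllDiff n d)

/-- The memory holds the instance and all the data that do not depend on the current value. -/
structure Prepared (σ : Memory) : Prop where
  loaded : I.Loaded σ
  count_eq : Holds d σ 12 (I.count (I.S ∩ I.T))
  slackS_eq : Holds d σ 13 (I.slack (I.S \ I.T))
  slackT_eq : Holds d σ 14 (I.slack (I.T \ I.S))
  dist_eq : Holds d σ 15 I.dist
  flag_iff : σ 17 0 = 0 ↔ I.Consistent

variable {I}

theorem Prepared.congr {σ τ : Memory} (h : I.Prepared σ)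
    (hτ : ∀ k < 18, k ≠ 5 → τ k = σ k) : I.Prepared τ where
  loaded := h.loaded.congr (hτ 0 (by decide) (by decide)) (hτ 1 (by decide) (by decide))
    (hτ 2 (by decide) (by decide)) (hτ 3 (by decide) (by decide)) (hτ 4 (by decide) (by decide))
    (hτ 6 (by decide) (by decide))
  count_eq := h.count_eq.congr (hτ 12 (by decide) (by decide))
  slackS_eq := h.slackS_eq.congr (hτ 13 (by decide) (by decide))
  slackT_eq := h.slackT_eq.congr (hτ 14 (by decide) (by decide))
  dist_eq := h.dist_eq.congr (hτ 15 (by decide) (by decide))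
  flag_iff := by rw [hτ 17 (by decide) (by decide), h.flag_iff]

theorem Prepared.exec {σ : Memory} (h : I.Prepared σ) (p : LoopProg)
    (hp : ∀ k ∈ p.writes, 18 ≤ k ∨ k = 5) : I.Prepared (p.exec n d σ) :=
  h.congr fun k h1 h2 => exec_of_notMem_writes p σ fun hk => by
    have := hp k hk
    omega

theorem exec_initReach {σ : Memory} (h : I.Prepared σ) {Q : Finset (Fin n)} {k s : ℕ} (hk : 24 < k)
    (hs : s < 18) (hsQ : Holds d σ s (I.slack Q)) :
    Holds d ((initReach k s).exec n d σ) k fun x y => I.dist x 0 + I.slack Q 0 y := by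
  refine exec_fill _ h.loaded.row (by omega) (by omega) (by omega) ?_
  intro x hx y hy τ h21 h22 hfr _
  have hd := h.dist_eq x hx 0 (by omega)
  have hq := hsQ 0 (by omega) y hy
  simp only [RExpr.eval, h21, h22, hfr 6 (by omega) (by omega) (by omega),
    hfr 15 (by omega) (by omega) (by omega), hfr s (by omega) (by omega) (by omega),
    h.loaded.row x hx, h.loaded.row 0 (by omega), hd, hq]

/-- Passing to the next value admits just one more start, `p = w`. So the table is carried along at
constant cost per entry. -/
theorem exec_updateReach {σ : Memory} (h : I.Prepared σ) {Q : Finset (Fin n)} {k s w : ℕ}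
    (hk : 24 < k) (hs : s < 18) (hsQ : Holds d σ s (I.slack Q)) (hw : σ 24 0 = w) (hwd : w < d)
    (hkQ : Holds d σ k fun x y =>
      runMin (I.dist x 0 + I.slack Q 0 y) (fun p => I.dist x p + I.slack Q p y) w) :
    Holds d ((updateReach k s).exec n d σ) k (I.reach Q w) := by
  refine exec_fill _ h.loaded.row (by omega) (by omega) (by omega) ?_
  intro x hx y hy τ h21 h22 hfr hown
  have hd := h.dist_eq x hx w (by omega)
  have hq := hsQ w (by omega) y hy
  simp only [eval_minExpr, RExpr.eval, h21, h22, hfr 6 (by omega) (by omega) (by omega),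
    hfr 15 (by omega) (by omega) (by omega), hfr s (by omega) (by omega) (by omega),
    hfr 24 (by omega) (by omega) (by omega), hw,
    h.loaded.row x hx, h.loaded.row w (by omega), hd, hq, hown, hkQ x hx y hy]
  rfl

theorem exec_computePast {σ : Memory} (hI : I.Loaded σ) {Q : Finset (Fin n)} {k s w : ℕ}
    (hk : 24 < k) (hs : 24 < s) (hks : k ≠ s) (hw : σ 24 0 = w) (hwd : w < d)
    (hsQ : Holds d σ s (I.reach Q w)) :
    ∀ x ≤ d, (computePast k s).exec n d σ k x = I.reachPast Q w x := by
  rw [computePast, LoopProg.exec]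
  have h0 : ∀ x ≤ d, (fillRow k (entry s rowReg dExpr)).exec n d σ k x = I.reach Q w x d := by
    refine exec_fillRow _ (by omega) ?_
    intro x hx τ h21 hfr _
    simp only [RExpr.eval, h21, hfr 6 (by omega) (by omega), hfr s (by omega) (by omega),
      hfr 0 (by omega) (by omega), hI.d_eq, hI.row x hx, hsQ x hx d le_rfl]
  have hfr0 : ∀ j, j ≠ k → j ≠ 21 →
      (fillRow k (entry s rowReg dExpr)).exec n d σ j = σ j := fun j h1 h2 =>
    exec_of_notMem_writes _ _ (by simp [h1, h2])
  set σ₀ := (fillRow k (entry s rowReg dExpr)).exec n d σ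
  refine exec_loop_induction (n := n) (d := d) (r := 22) (b := .dSucc) (σ := σ₀)
    (fun j τ => ∀ x ≤ d, τ k x =
      runMin (I.reach Q w x d) (fun y => I.reach Q w x (max y (w + 1))) j) ?_ ?_
  · intro x hx
    rw [setReg_of_ne (by omega), h0 x hx]
    rfl
  · intro j hj τ hτ hfr ih x hx
    replace hj : j ≤ d := Nat.lt_succ_iff.1 hj
    rw [setReg_of_ne (by omega)]
    have hall : ∀ i, i ≠ k → i ≠ 21 → i ≠ 22 → τ i = σ i := fun i h1 h2 h3 => by
      rw [hfr i h3 (by simp [h1, h2]), hfr0 i h1 h2]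
    refine exec_fillRow (n := n) (fun x =>
      runMin (I.reach Q w x d) (fun y => I.reach Q w x (max y (w + 1))) (j + 1)) (by omega) ?_ x hx
    intro x hx ρ h21 hfr' hown
    have hmax : max j (w + 1) ≤ d := by omega
    simp only [eval_minExpr, eval_maxExpr, RExpr.eval, h21, hown,
      hfr' 6 (by omega) (by omega), hfr' s (by omega) (by omega), hfr' 22 (by omega) (by decide),
      hfr' 24 (by omega) (by decide), hall 6 (by omega) (by decide) (by decide),
      hall s (by omega) (by omega) (by omega), hall 24 (by omega) (by omega) (by omega), hτ, hw,
      hI.row x hx, hsQ x hx _ hmax, ih x hx]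
    rfl

theorem exec_computeTwice {σ : Memory} (hI : I.Loaded σ) {w : ℕ}
    (h30 : Holds d σ 30 (I.reach (I.S \ I.T) w)) (h31 : Holds d σ 31 (I.reach (I.T \ I.S) w))
    (h32 : ∀ x ≤ d, σ 32 x = I.reachPast (I.S \ I.T) w x)
    (h33 : ∀ x ≤ d, σ 33 x = I.reachPast (I.T \ I.S) w x) :
    Holds d (computeTwice.exec n d σ) 34 (I.reachTwice w) := by
  refine exec_fill _ hI.row (by decide) (by decide) (by decide) ?_
  intro x hx y hy τ h21 h22 hfr _
  simp only [eval_minExpr, RExpr.eval, h21, h22, hfr 0 (by decide) (by decide) (by decide),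
    hfr 6 (by decide) (by decide) (by decide), hfr 30 (by decide) (by decide) (by decide),
    hfr 31 (by decide) (by decide) (by decide), hfr 32 (by decide) (by decide) (by decide),
    hfr 33 (by decide) (by decide) (by decide), hI.d_eq, hI.row x hx, hI.row d le_rfl,
    h30 x hx y hy, h31 x hx y hy, h30 d le_rfl y hy, h31 d le_rfl y hy, h32 x hx, h33 x hx,
    h32 d le_rfl, h33 d le_rfl]
  rfl

theorem exec_computeCover {σ : Memory} (hI : I.Loaded σ) {w : ℕ} (hw : σ 24 0 = w) (hwd : w < d)
    (h15 : Holds d σ 15 I.dist) (h34 : Holds d σ 34 (I.reachTwice w)) :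
    Holds d (computeCover.exec n d σ) 35 (I.coverCost w) := by
  rw [computeCover, LoopProg.exec]
  have h0 : Holds d ((fill 35 (.add (entry 34 rowReg dExpr) (entry 15 dExpr colReg))).exec n d σ) 35
      fun x y => I.reachTwice w x d + I.dist d y := by
    refine exec_fill _ hI.row (by decide) (by decide) (by decide) ?_
    intro x hx y hy τ h21 h22 hfr _
    simp only [RExpr.eval, h21, h22, hfr 0 (by decide) (by decide) (by decide),
      hfr 6 (by decide) (by decide) (by decide), hfr 15 (by decide) (by decide) (by decide),
      hfr 34 (by decide) (by decide) (by decide), hI.d_eq, hI.row x hx, hI.row d le_rfl,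
      h34 x hx d le_rfl, h15 d le_rfl y hy]
  have hfr0 : ∀ j, j ≠ 35 → j ≠ 21 → j ≠ 22 →
      (fill 35 (.add (entry 34 rowReg dExpr) (entry 15 dExpr colReg))).exec n d σ j = σ j :=
    fun j h1 h2 h3 => exec_of_notMem_writes _ _ (by simp [h1, h2, h3])
  set σ₀ := (fill 35 (.add (entry 34 rowReg dExpr) (entry 15 dExpr colReg))).exec n d σ
  refine exec_loop_induction (n := n) (d := d) (r := 23) (b := .n) (σ := σ₀)
    (fun j τ => Holds d τ 35 fun x y => runMin (I.reachTwice w x d + I.dist d y)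
      (fun i => I.reachTwice w x (max (arrayOf I.ub i) (w + 1)) +
        I.dist (max (arrayOf I.ub i) (w + 1)) y) j) ?_ ?_
  · exact h0.congr (setReg_of_ne (by decide) _ _)
  · intro j hj τ hτ hfr ih
    refine Holds.congr ?_ (setReg_of_ne (by decide) _ _)
    have hall : ∀ i, i ≠ 35 → i ≠ 21 → i ≠ 22 → i ≠ 23 → τ i = σ i := fun i h1 h2 h3 h4 => by
      rw [hfr i h4 (by simp [h1, h2, h3]), hfr0 i h1 h2 h3]
    have hrow : ∀ x ≤ d, τ 6 x = x * (d + 1) := fun x hx => by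
      rw [hall 6 (by decide) (by decide) (by decide) (by decide), hI.row x hx]
    refine exec_fill _ hrow (by decide) (by decide) (by decide) ?_
    intro x hx y hy ρ h21 h22 hfr' hown
    have hub : arrayOf I.ub j = I.ub ⟨j, hj⟩ := dif_pos hj
    have hub' := hI.ub_eq ⟨j, hj⟩
    dsimp only at hub'
    have hmax : max (I.ub ⟨j, hj⟩) (w + 1) ≤ d := max_le (I.ub_le _) hwd
    simp only [eval_minExpr, eval_maxExpr, RExpr.eval, h21, h22, hown,
      hfr' 2 (by decide) (by decide) (by decide), hfr' 6 (by decide) (by decide) (by decide),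
      hfr' 15 (by decide) (by decide) (by decide), hfr' 34 (by decide) (by decide) (by decide),
      hfr' 23 (by decide) (by decide) (by decide), hfr' 24 (by decide) (by decide) (by decide),
      hall 2 (by decide) (by decide) (by decide) (by decide),
      hall 15 (by decide) (by decide) (by decide) (by decide),
      hall 34 (by decide) (by decide) (by decide) (by decide),
      hall 24 (by decide) (by decide) (by decide) (by decide), hτ, hw, hub',
      hrow x hx, hrow _ hmax, h34 x hx _ hmax, h15 _ hmax y hy, ih x hx y hy, runMin, hub]

theorem exec_testExcluded {σ : Memory} (h : I.Prepared σ) {w : ℕ} {i : Fin n} (hi : σ 23 0 = i)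
    (h35 : Holds d σ 35 (I.coverCost w)) :
    testExcluded.exec n d σ 36 0 = 0 ↔ I.Consistent ∧ ¬ I.Excluded w i := by
  rw [testExcluded, LoopProg.exec, exec_accumulate (fun x y => 1 - (I.coverCost w x y +
    (1 - (x + 1 - I.lb i + (I.ub i - y))) - (1 + I.count (I.S ∩ I.T) x y))) (by decide) (by decide)]
  · have h0 : (LoopProg.set 36 (.const 0) (reg 17)).exec n d σ 36 0 = σ 17 0 := by
      simp [LoopProg.exec, RExpr.eval]
    rw [h0, Nat.add_eq_zero_iff, h.flag_iff]
    refine and_congr_right fun _ => ?_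
    simp only [Finset.sum_eq_zero_iff, Finset.mem_range, Nat.lt_succ_iff, Excluded, not_exists,
      not_and]
    refine forall₄_congr fun x _ y _ => ?_
    split_ifs <;> omega
  · intro x hx y hy τ h21 h22 hfr
    have hall : ∀ j, j ≠ 36 → j ≠ 21 → j ≠ 22 → τ j = σ j := fun j h1 h2 h3 => by
      rw [hfr j h1 h2 h3, exec_of_notMem_writes _ _ (by simp [writes, h1])]
    simp only [outsideExpr, RExpr.eval, h21, h22, hall 1 (by decide) (by decide) (by decide),
      hall 2 (by decide) (by decide) (by decide), hall 6 (by decide) (by decide) (by decide),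
      hall 12 (by decide) (by decide) (by decide), hall 23 (by decide) (by decide) (by decide),
      hall 35 (by decide) (by decide) (by decide), hi, h.loaded.lb_eq, h.loaded.ub_eq,
      h.loaded.row x hx, h35 x hx y hy, h.count_eq x hx y hy]

/-- The variable `i` keeps the value `w + 1`. -/
def Keeps (I : OverlappingAllDiff n d) (i : Fin n) (w : ℕ) : Prop :=
  w + 1 ∈ I.dom i ∧ (i ∈ I.S ∩ I.T → I.Consistent ∧ ¬ I.Excluded w i)

/-- The second part says that columns written for other values survive; it rests on injectivity of
row-major indices. -/
theorem exec_writeColumn {σ : Memory} (h : I.Prepared σ) {w : ℕ} (hw : σ 24 0 = w) (hwd : w < d)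
    (h35 : Holds d σ 35 (I.coverCost w)) (i : Fin n) (w' : ℕ) (hw' : w' < d) :
    (w' = w → (writeColumn.exec n d σ 5 (i * (d + 1) + (w' + 1)) ≠ 0 ↔ I.Keeps i w)) ∧
    (w' ≠ w → writeColumn.exec n d σ 5 (i * (d + 1) + (w' + 1)) =
      σ 5 (i * (d + 1) + (w' + 1))) := by
  have key := exec_loop_induction (n := n) (d := d) (r := 23) (b := .n) (σ := σ)
    (p := .seq testExcluded (.set 5 (.add (.cell 6 varReg) (succExpr valReg)) keepExpr))
    (fun j τ => ∀ i : Fin n, ∀ w' < d,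
      ((i : ℕ) < j → w' = w → (τ 5 (i * (d + 1) + (w' + 1)) ≠ 0 ↔ I.Keeps i w)) ∧
      (w' ≠ w → τ 5 (i * (d + 1) + (w' + 1)) = σ 5 (i * (d + 1) + (w' + 1))))
    (by
      intro i w' _
      exact ⟨fun h => absurd h (Nat.not_lt_zero _), fun _ => by rw [setReg_of_ne (by decide)]⟩) (by
      intro j hj τ hτ hfr ih i w' hw'
      rw [setReg_of_ne (by decide)]
      have hall : ∀ k, k ≠ 5 → k ≠ 36 → k ≠ 21 → k ≠ 22 → k ≠ 23 → τ k = σ k :=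
        fun k h1 h2 h3 h4 h5 => hfr k h5 (by simp [testExcluded, writes, h1, h2, h3, h4])
      have hτP : I.Prepared τ := h.congr fun k h1 h2 =>
        hall k h2 (by omega) (by omega) (by omega) (by omega)
      have h35τ : Holds d τ 35 (I.coverCost w) :=
        h35.congr (hall 35 (by decide) (by decide) (by decide) (by decide) (by decide))
      have htest := exec_testExcluded hτP (i := ⟨j, hj⟩) (w := w) hτ h35τ
      have hall' : ∀ k, k ≠ 36 → k ≠ 21 → k ≠ 22 → testExcluded.exec n d τ k = τ k :=
        fun k h1 h2 h3 => exec_of_notMem_writes _ _ (by simp [testExcluded, writes, h1, h2, h3])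
      have hnew : keepExpr.eval (testExcluded.exec n d τ) ≠ 0 ↔ I.Keeps ⟨j, hj⟩ w := by
        have g1 := hτP.loaded.lb_eq ⟨j, hj⟩
        have g2 := hτP.loaded.ub_eq ⟨j, hj⟩
        have g3 := hτP.loaded.S_eq ⟨j, hj⟩
        have g4 := hτP.loaded.T_eq ⟨j, hj⟩
        dsimp only at g1 g2 g3 g4
        simp only [keepExpr, RExpr.eval, hall' 1 (by decide) (by decide) (by decide),
          hall' 2 (by decide) (by decide) (by decide), hall' 3 (by decide) (by decide) (by decide),
          hall' 4 (by decide) (by decide) (by decide), hall' 23 (by decide) (by decide) (by decide),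
          hall' 24 (by decide) (by decide) (by decide), hτ, g1, g2, g3, g4,
          hall 24 (by decide) (by decide) (by decide) (by decide) (by decide), hw, Keeps, dom,
          Finset.mem_Icc, Finset.mem_inter, ← htest]
        split_ifs with hS hT hT <;> simp only [hS, hT, and_true, and_false,
          forall_const, false_implies] <;> omega
      have h24 : testExcluded.exec n d τ 24 0 = w := by
        rw [hall' 24 (by decide) (by decide) (by decide),
          hall 24 (by decide) (by decide) (by decide) (by decide) (by decide), hw]
      have h23 : testExcluded.exec n d τ 23 0 = j := by
        rw [hall' 23 (by decide) (by decide) (by decide), hτ]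
      have h6 : testExcluded.exec n d τ 6 j = j * (d + 1) := by
        rw [hall' 6 (by decide) (by decide) (by decide), hτP.loaded.row_eq j (by
          simp only [LoopBound.val] at hj
          omega)]
      have hstep : (LoopProg.seq testExcluded
          (.set 5 (.add (.cell 6 varReg) (succExpr valReg)) keepExpr)).exec n d τ 5 =
          Function.update (τ 5) (j * (d + 1) + (w + 1))
            (keepExpr.eval (testExcluded.exec n d τ)) := by
        simp only [LoopProg.exec, Function.update_self, RExpr.eval, h23, h24, h6,
          hall' 5 (by decide) (by decide) (by decide)]
      rw [hstep]
      obtain ⟨ih1, ih2⟩ := ih i w' hw'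
      constructor
      · rintro hij rfl
        by_cases hieq : (i : ℕ) = j
        · obtain rfl : i = ⟨j, hj⟩ := Fin.ext hieq
          rw [Function.update_self]
          exact hnew
        · rw [Function.update_of_ne fun he => hieq (rowMajor_inj (by omega) (by omega) he).1]
          exact ih1 (by omega) rfl
      · intro hne
        rw [Function.update_of_ne fun he => hne (by
          have := (rowMajor_inj (by omega) (by omega) he).2
          omega)]
        exact ih2 hne)
  obtain ⟨k1, k2⟩ := key i w' hw'
  exact ⟨k1 i.2, k2⟩

/-- The memory before the value `w + 1` is treated. -/
structure Processed (I : OverlappingAllDiff n d) (w : ℕ) (σ : Memory) : Prop where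
  prepared : I.Prepared σ
  reachS_eq : Holds d σ 30 fun x y => runMin (I.dist x 0 + I.slack (I.S \ I.T) 0 y)
    (fun p => I.dist x p + I.slack (I.S \ I.T) p y) w
  reachT_eq : Holds d σ 31 fun x y => runMin (I.dist x 0 + I.slack (I.T \ I.S) 0 y)
    (fun p => I.dist x p + I.slack (I.T \ I.S) p y) w
  out_iff : ∀ i : Fin n, ∀ w' < w, w' < d → (σ 5 (i * (d + 1) + (w' + 1)) ≠ 0 ↔ I.Keeps i w')

theorem exec_processValue {σ : Memory} {w : ℕ} (h : I.Processed w σ) (hw : σ 24 0 = w) (hwd : w < d) :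
    I.Processed (w + 1) (processValue.exec n d σ) := by
  obtain ⟨hP, hS, hT, hout⟩ := h
  simp only [processValue, LoopProg.exec]
  have hP1 := hP.exec (updateReach 30 13) (by simp [updateReach])
  have hw1 : (updateReach 30 13).exec n d σ 24 0 = w := by
    rw [exec_of_notMem_writes _ _ (by simp [updateReach]), hw]
  have a1 := exec_updateReach hP (k := 30) (by decide) (by decide) hP.slackS_eq hw hwd hS
  have b1 := hT.exec (n := n) (updateReach 30 13) (by simp [updateReach])
  have o1 : (updateReach 30 13).exec n d σ 5 = σ 5 :=
    exec_of_notMem_writes _ _ (by simp [updateReach])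
  set σ1 := (updateReach 30 13).exec n d σ
  have hP2 := hP1.exec (updateReach 31 14) (by simp [updateReach])
  have hw2 : (updateReach 31 14).exec n d σ1 24 0 = w := by
    rw [exec_of_notMem_writes _ _ (by simp [updateReach]), hw1]
  have a2 := a1.exec (n := n) (updateReach 31 14) (by simp [updateReach])
  have b2 := exec_updateReach hP1 (k := 31) (by decide) (by decide) hP1.slackT_eq hw1 hwd b1
  have o2 : (updateReach 31 14).exec n d σ1 5 = σ 5 := by
    rw [exec_of_notMem_writes _ _ (by simp [updateReach]), o1]
  set σ2 := (updateReach 31 14).exec n d σ1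
  have hP3 := hP2.exec (computePast 32 30) (by simp [computePast, writes])
  have hw3 : (computePast 32 30).exec n d σ2 24 0 = w := by
    rw [exec_of_notMem_writes _ _ (by simp [computePast, writes]), hw2]
  have a3 := a2.exec (n := n) (computePast 32 30) (by simp [computePast, writes])
  have b3 := b2.exec (n := n) (computePast 32 30) (by simp [computePast, writes])
  have c3 := exec_computePast hP2.loaded (k := 32) (s := 30) (by decide) (by decide) (by decide) hw2
    hwd a2
  have o3 : (computePast 32 30).exec n d σ2 5 = σ 5 := by
    rw [exec_of_notMem_writes _ _ (by simp [computePast, writes]), o2]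
  set σ3 := (computePast 32 30).exec n d σ2
  have hP4 := hP3.exec (computePast 33 31) (by simp [computePast, writes])
  have hw4 : (computePast 33 31).exec n d σ3 24 0 = w := by
    rw [exec_of_notMem_writes _ _ (by simp [computePast, writes]), hw3]
  have a4 := a3.exec (n := n) (computePast 33 31) (by simp [computePast, writes])
  have b4 := b3.exec (n := n) (computePast 33 31) (by simp [computePast, writes])
  have c4 : ∀ x ≤ d, (computePast 33 31).exec n d σ3 32 x = I.reachPast (I.S \ I.T) w x :=
    fun x hx => by rw [exec_of_notMem_writes _ _ (by simp [computePast, writes]), c3 x hx]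
  have d4 := exec_computePast hP3.loaded (k := 33) (s := 31) (by decide) (by decide) (by decide) hw3
    hwd b3
  have o4 : (computePast 33 31).exec n d σ3 5 = σ 5 := by
    rw [exec_of_notMem_writes _ _ (by simp [computePast, writes]), o3]
  set σ4 := (computePast 33 31).exec n d σ3
  have hP5 := hP4.exec computeTwice (by simp [computeTwice])
  have hw5 : computeTwice.exec n d σ4 24 0 = w := by
    rw [exec_of_notMem_writes _ _ (by simp [computeTwice]), hw4]
  have a5 := a4.exec (n := n) computeTwice (by simp [computeTwice])
  have b5 := b4.exec (n := n) computeTwice (by simp [computeTwice])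
  have e5 := exec_computeTwice hP4.loaded a4 b4 c4 d4
  have o5 : computeTwice.exec n d σ4 5 = σ 5 := by
    rw [exec_of_notMem_writes _ _ (by simp [computeTwice]), o4]
  set σ5 := computeTwice.exec n d σ4
  have hP6 := hP5.exec computeCover (by simp [computeCover, writes])
  have hw6 : computeCover.exec n d σ5 24 0 = w := by
    rw [exec_of_notMem_writes _ _ (by simp [computeCover, writes]), hw5]
  have a6 := a5.exec (n := n) computeCover (by simp [computeCover, writes])
  have b6 := b5.exec (n := n) computeCover (by simp [computeCover, writes])
  have e6 := exec_computeCover hP5.loaded hw5 hwd hP5.dist_eq e5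
  have o6 : computeCover.exec n d σ5 5 = σ 5 := by
    rw [exec_of_notMem_writes _ _ (by simp [computeCover, writes]), o5]
  set σ6 := computeCover.exec n d σ5
  refine ⟨hP6.exec _ (by simp [writeColumn, testExcluded, writes]),
    a6.exec _ (by simp [writeColumn, testExcluded, writes]),
    b6.exec _ (by simp [writeColumn, testExcluded, writes]), ?_⟩
  intro i w' hw' hwd'
  obtain ⟨k1, k2⟩ := exec_writeColumn hP6 hw6 hwd e6 i w' hwd'
  by_cases hww : w' = w
  · rw [k1 hww, hww]
  · rw [k2 hww, o6]
    exact hout i w' (by omega) hwd'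

theorem exec_ruleThree_ne_zero_iff (I : OverlappingAllDiff n d) (i : Fin n) {w : ℕ} (hw : w < d) :
    ruleThree.exec n d I.initialMemory 5 (i * (d + 1) + (w + 1)) ≠ 0 ↔ I.Keeps i w := by
  simp only [ruleThree, LoopProg.exec]
  have hI0 := loaded_exec_rowOffsets I
  have z : ∀ k, 6 < k → k < 21 → ∀ j, rowOffsets.exec n d I.initialMemory k j = 0 := by
    intro k h1 h2 j
    rw [exec_of_notMem_writes _ _ (by simp [rowOffsets, writes]; omega)]
    unfold initialMemory
    split <;> first | omega | rfl
  set σ0 := rowOffsets.exec n d I.initialMemory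
  have hI1 := hI0.exec computeCounts (by simp [computeCounts, tally, writes])
  obtain ⟨a1, b1, c1⟩ := exec_computeCounts hI0 (z 10 (by decide) (by decide))
    (z 11 (by decide) (by decide)) (z 12 (by decide) (by decide))
  have f1 : computeCounts.exec n d σ0 17 0 = 0 := by
    rw [exec_of_notMem_writes _ _ (by simp [computeCounts, tally, writes]),
      z 17 (by decide) (by decide)]
  set σ1 := computeCounts.exec n d σ0
  have hI2 := hI1.exec computeSlacks (by simp [computeSlacks, writes])
  have a2 := a1.exec (n := n) computeSlacks (by simp [computeSlacks, writes])
  have b2 := b1.exec (n := n) computeSlacks (by simp [computeSlacks, writes])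
  have c2 := c1.exec (n := n) computeSlacks (by simp [computeSlacks, writes])
  obtain ⟨d2, e2⟩ := exec_computeSlacks hI1 a1 b1
  have f2 : computeSlacks.exec n d σ1 17 0 = 0 := by
    rw [exec_of_notMem_writes _ _ (by simp [computeSlacks, writes]), f1]
  set σ2 := computeSlacks.exec n d σ1
  have hI3 := hI2.exec computeDist (by simp [computeDist, writes])
  have a3 := a2.exec (n := n) computeDist (by simp [computeDist, writes])
  have b3 := b2.exec (n := n) computeDist (by simp [computeDist, writes])
  have c3 := c2.exec (n := n) computeDist (by simp [computeDist, writes])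
  have d3 := d2.exec (n := n) computeDist (by simp [computeDist, writes])
  have e3 := e2.exec (n := n) computeDist (by simp [computeDist, writes])
  have g3 := exec_computeDist hI2 d2 e2
  have f3 : computeDist.exec n d σ2 17 0 = 0 := by
    rw [exec_of_notMem_writes _ _ (by simp [computeDist, writes]), f2]
  set σ3 := computeDist.exec n d σ2
  have hP4 : I.Prepared (computeFlag.exec n d σ3) :=
    ⟨hI3.exec _ (by simp [computeFlag]), c3.exec _ (by simp [computeFlag]),
      d3.exec _ (by simp [computeFlag]), e3.exec _ (by simp [computeFlag]),
      g3.exec _ (by simp [computeFlag]), exec_computeFlag hI3 f3 a3 b3 c3 g3⟩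
  set σ4 := computeFlag.exec n d σ3
  have hP5 := hP4.exec (initReach 30 13) (by simp [initReach])
  have a5 := exec_initReach hP4 (k := 30) (by decide) (by decide) hP4.slackS_eq
  set σ5 := (initReach 30 13).exec n d σ4
  have hP6 := hP5.exec (initReach 31 14) (by simp [initReach])
  have a6 := a5.exec (n := n) (initReach 31 14) (by simp [initReach])
  have b6 := exec_initReach hP5 (k := 31) (by decide) (by decide) hP5.slackT_eq
  set σ6 := (initReach 31 14).exec n d σ5
  have key := exec_loop_induction (n := n) (d := d) (r := 24) (b := .d) (p := processValue) (σ := σ6)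
    (I.Processed)
    ⟨hP6.congr fun k h _ => setReg_of_ne (by omega) _ _,
      a6.congr (setReg_of_ne (by decide) _ _), b6.congr (setReg_of_ne (by decide) _ _),
      fun i w' h => absurd h (Nat.not_lt_zero _)⟩ (by
      intro j hj τ hτ _ ih
      obtain ⟨q1, q2, q3, q4⟩ := exec_processValue ih hτ hj
      exact ⟨q1.congr fun k h _ => setReg_of_ne (by omega) _ _,
        q2.congr (setReg_of_ne (by decide) _ _), q3.congr (setReg_of_ne (by decide) _ _),
        by rwa [setReg_of_ne (by decide)]⟩)
  exact key.out_iff i w hw hw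

end OverlappingAllDiff

/-! ### Assembly of running time and output. -/

theorem theoremt :
    ∃ (p : RProg) (C : ℕ), ∀ (n d : ℕ) (_ : 0 < n) (I : OverlappingAllDiff n d)
      (lo hi : DVar n → ℕ) (_ : I.AtFixpoint lo hi),
      ∃ (t : ℕ) (τ : Memory), Runs p I.initialMemory t τ ∧ t ≤ C * (n * d ^ 3) ∧
        EnforcesRuleThree I.dom I.S I.T (outputDomains n d τ) := by
  refine ⟨LoopProg.ruleThree.toProg, LoopProg.ruleThree.coeff, fun n d hn I _ _ _ => ?_⟩
  -- Some variable exists and has a nonempty domain; `1 ≤ d` is needed to bound `d + 1` and `n + d`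
  -- by monomials.
  have hd : 1 ≤ d := (I.one_le_lb ⟨0, hn⟩).trans ((I.lb_le_ub _).trans (I.ub_le _))
  obtain ⟨t, ht, hrun⟩ := LoopProg.exists_runs_exec hn hd LoopProg.ruleThree
    LoopProg.wellFormed_ruleThree I.initialMemory
    (by simp [OverlappingAllDiff.initialMemory, arrayOf])
    (by simp [OverlappingAllDiff.initialMemory, arrayOf])
  rw [LoopProg.degN_ruleThree, LoopProg.degD_ruleThree, pow_one] at ht
  refine ⟨t, _, hrun, ht, I.enforcesRuleThree_of_mem_iff fun i v => ?_⟩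
  rw [outputDomains, Finset.mem_filter, Finset.mem_Icc]
  constructor
  · rintro ⟨⟨h1, h2⟩, h3⟩
    obtain ⟨w, rfl⟩ : ∃ w, v = w + 1 := ⟨v - 1, by omega⟩
    exact (I.exec_ruleThree_ne_zero_iff i (by omega)).1 h3
  · intro h
    have h1 := Finset.mem_Icc.1 h.1
    have h2 := I.one_le_lb i
    have h3 := I.ub_le i
    obtain ⟨w, rfl⟩ : ∃ w, v = w + 1 := ⟨v - 1, by omega⟩
    exact ⟨by omega, (I.exec_ruleThree_ne_zero_iff i (by omega)).2 h⟩
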